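/- Consider discrete memoryless broadcast channels $p(y_1,y_2,y_3\mid x)$ with three receivers, a nonempty finite input alphabet $\mathcal X$ and finite output alphabets $\mathcal Y_1,\mathcal Y_2,\mathcal Y_3$. For each nonempty $\mathcal I\subseteq\{1,2,3\}$ there is a message $W_{\mathcal I}$, of rate $R_{\mathcal I}$, intended for all receivers $i\in\mathcal I$; write $\mathbf R=(R_1,R_2,R_3,R_{12},R_{13},R_{23},R_{123})\in\mathbb R_+^7$, where $\mathbb R_+=[0,\infty)$. A code of length $n$ consists of an encoder $\prod_{\mathcal I}\{1,\dots,\lfloor 2^{nR_{\mathcal I}}\rfloor\}\to\mathcal X^n$ and, for each receiver $i$ and each $\mathcal I\ni i$, a decoder $\mathcal Y_i^n\to\{1,\dots,\lfloor 2^{nR_{\mathcal I}}\rfloor\}$. Its error probability is the probability that some receiver decodes some message intended for it incorrectly when the messages are independent and uniform. The rate vector $\mathbf R$ is achievable if there is a sequence of such codes ($n\to\infty$) with error probability tending to $0$, and the multicast capacity region $\mathcal C\subseteq\mathbb R_+^7$ is the closure of the set of achievable rate vectors. For a weight vector $\alpha$ let $$\mathcal C^*(\alpha)=\{\mathbf R\in\mathbb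 R_+^7:\ \alpha^T\mathbf R\le\alpha^T\mathbf R^*(\alpha)\},\qquad \mathbf R^*(\alpha)\in\arg\max_{\mathbf R\in\mathcal C}\alpha^T\mathbf R .$$ Let $$\mathbf H_{BC,3}=\left[\begin{array}{rrrrrrrrrrrrrrrr} -1&-1&0&1&0&0&1&0&0&-1&0&0&0&0&0&0\\ -1&0&-1&0&1&0&0&-1&0&0&1&0&0&0&0&0\\ 0&-1&-1&0&0&-1&0&0&1&0&0&1&0&0&0&0\\ 1&0&0&-1&-1&-1&0&0&0&0&0&0&1&0&0&-1\\ 0&1&0&0&0&0&-1&-1&-1&0&0&0&0&1&0&-1\\ 0&0&1&0&0&0&0&0&0&-1&-1&-1&0&0&1&-1\\ 0&0&0&0&0&1&0&1&0&1&0&0&-1&-1&-1&2 \end{array}\right],\qquad \mathcal H_3^*=\{\alpha\in\mathbb R_+^7:\ \alpha^T\mathbf H_{BC,3}\le 0\ \text{entrywise}\}.$$ Then: 1. For every such channel, $\mathcal C=\bigcap_{\alpha\in\mathcal H_3^*}\mathcal C^*(\alpha)$ (in particular the maxima exist). 2. Let $\mathcal H\subseteq\mathbb R_+^7$. The equality $\mathcal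 C=\bigcap_{\alpha\in\mathcal H}\mathcal C^*(\alpha)$ holds for all such channels if and only if $\mathcal H_3^*$ is contained in the closure of $\{t\alpha: t\ge 0,\ \alpha\in\mathcal H\}$. In particular, if $\mathcal H$ is closed and closed under multiplication by positive scalars, the equality holds for all such channels if and only if $\mathcal H\supseteq\mathcal H_3^*$. 3. Boundary normals lie in $\mathcal H_3^*$: for every such channel, if $\mathbf R\in\mathcal C$ has all entries positive and $\alpha\in\mathbb R^7$ satisfies $\alpha^T\mathbf R=\max_{\mathbf R'\in\mathcal C}\alpha^T\mathbf R'$, then $\alpha\in\mathcal H_3^*$; and for every $\mathbf R\in\mathcal C$ that lies in the closure of $\mathbb R_+^7\setminus\mathcal C$ there is a nonzero $\alpha\in\mathcal H_3^*$ with $\alpha^T\mathbf R=\max_{\mathbf R'\in\mathcal C}\alpha^T\mathbf R'$. -/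

import Mathlib

/-- The recipients of the seven messages, in the order
`W₁, W₂, W₃, W₁₂, W₁₃, W₂₃, W₁₂₃` (receivers are numbered `0, 1, 2`). -/
def recipients : Fin 7 → Finset (Fin 3) :=
  ![{0}, {1}, {2}, {0, 1}, {0, 2}, {1, 2}, {0, 1, 2}]

/-- A discrete memoryless broadcast channel with three receivers: a finite nonempty input alphabet
`X`, finite output alphabets `Y 0, Y 1, Y 2` and a probability transition function
`p x (y₁, y₂, y₃)`. -/
structure BroadcastChannel where
  X : Type
  Y : Fin 3 → Type
  fintypeX : Fintype X
  nonemptyX : Nonempty X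
  fintypeY : ∀ i, Fintype (Y i)
  p : X → (∀ i, Y i) → ℝ
  p_nonneg : ∀ x y, 0 ≤ p x y
  p_sum : ∀ x, ∑ y, p x y = 1

attribute [instance] BroadcastChannel.fintypeX BroadcastChannel.nonemptyX
  BroadcastChannel.fintypeY

namespace BroadcastChannel

/-- The number of values `{1, …, 2^{n R_I}}` of the message `W_I` in a code of length `n` and
rate vector `R`. -/
noncomputable def messageCount (R : Fin 7 → ℝ) (n : ℕ) (I : Fin 7) : ℕ :=
  ⌊(2 : ℝ) ^ ((n : ℝ) * R I)⌋₊

/-- A code of block length `n` with `M I` values of the message `I`: an encoder and, for each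
receiver `i` and each message `I` intended for it, a decoder. -/
structure Code (ch : BroadcastChannel) (n : ℕ) (M : Fin 7 → ℕ) where
  enc : (∀ I, Fin (M I)) → Fin n → ch.X
  dec : ∀ (i : Fin 3) (I : Fin 7), i ∈ recipients I → (Fin n → ch.Y i) → Fin (M I)

/-- With the messages `w` sent and the outputs `y` received, some receiver decodes some message
intended for it incorrectly. -/
def Code.Errs {ch : BroadcastChannel} {n : ℕ} {M : Fin 7 → ℕ} (c : Code ch n M)
    (w : ∀ I, Fin (M I)) (y : Fin n → ∀ i, ch.Y i) : Prop :=
  ∃ (i : Fin 3) (I : Fin 7) (h : i ∈ recipients I), c.dec i I h (fun t => y t i) ≠ w I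

open Classical in
/-- The probability of error, for independent and uniformly distributed messages, when the channel
is used `n` times without memory. -/
noncomputable def Code.errorProb {ch : BroadcastChannel} {n : ℕ} {M : Fin 7 → ℕ}
    (c : Code ch n M) : ℝ :=
  (∑ w : ∀ I, Fin (M I), ∑ y : Fin n → ∀ i, ch.Y i,
      if c.Errs w y then ∏ t, ch.p (c.enc w t) (y t) else 0) / ∏ I, (M I : ℝ)

/-- The rate vector `R ∈ ℝ₊⁷` is achievable. -/
def Achievable (ch : BroadcastChannel) (R : Fin 7 → ℝ) : Prop :=
  (∀ I, 0 ≤ R I) ∧ ∃ c : ∀ n : ℕ, Code ch n (messageCount R n),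
    Filter.Tendsto (fun n => (c n).errorProb) Filter.atTop (nhds 0)

/-- The multicast capacity region. -/
def capacityRegion (ch : BroadcastChannel) : Set (Fin 7 → ℝ) :=
  closure {R | ch.Achievable R}

/-- The points of the capacity region that maximise the weighted sum rate `αᵀ R`. -/
def sumRateMaximizers (ch : BroadcastChannel) (α : Fin 7 → ℝ) : Set (Fin 7 → ℝ) :=
  {R | R ∈ ch.capacityRegion ∧ ∀ R' ∈ ch.capacityRegion, α ⬝ᵥ R' ≤ α ⬝ᵥ R}

/-- The halfspace `C*(α)`: all `R ∈ ℝ₊⁷` with `αᵀ R ≤ αᵀ R*(α)`, where `R*(α)` is a maximiser of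
the weighted sum rate over the capacity region. -/
def supportingHalfspace (ch : BroadcastChannel) (α : Fin 7 → ℝ) : Set (Fin 7 → ℝ) :=
  {R | (∀ I, 0 ≤ R I) ∧ ∃ Rstar ∈ ch.sumRateMaximizers α, α ⬝ᵥ R ≤ α ⬝ᵥ Rstar}

end BroadcastChannel

/-- The matrix `H_{BC,3}`. -/
def HBC3 : Matrix (Fin 7) (Fin 16) ℝ :=
  !![-1, -1,  0,  1,  0,  0,  1,  0,  0, -1,  0,  0,  0,  0,  0,  0;
     -1,  0, -1,  0,  1,  0,  0, -1,  0,  0,  1,  0,  0,  0,  0,  0;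
      0, -1, -1,  0,  0, -1,  0,  0,  1,  0,  0,  1,  0,  0,  0,  0;
      1,  0,  0, -1, -1, -1,  0,  0,  0,  0,  0,  0,  1,  0,  0, -1;
      0,  1,  0,  0,  0,  0, -1, -1, -1,  0,  0,  0,  0,  1,  0, -1;
      0,  0,  1,  0,  0,  0,  0,  0,  0, -1, -1, -1,  0,  0,  1, -1;
      0,  0,  0,  0,  0,  1,  0,  1,  0,  1,  0,  0, -1, -1, -1,  2]

/-- The set `H*₃` of all `α ∈ ℝ₊⁷` with `αᵀ H_{BC,3} ≤ 0` entrywise. -/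
def Hstar3 : Set (Fin 7 → ℝ) :=
  {α | (∀ I, 0 ≤ α I) ∧ ∀ j, (Matrix.vecMul α HBC3) j ≤ 0}

/-- The union of the rays from the origin through the points of `A`. -/
def raysThrough (A : Set (Fin 7 → ℝ)) : Set (Fin 7 → ℝ) :=
  {x | ∃ t : ℝ, 0 ≤ t ∧ ∃ α ∈ A, x = t • α}

/-! The capacity region is compact and convex: bounded because a decoder distinguishes at most as
many values as there are output blocks, and convex by time sharing. It is therefore determined by
its supporting halfspaces, and the question is which normals occur.

Necessary conditions on a normal come from recoding. Rate of the messages in a set `D` can be traded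
for rate of another message `c` whenever `D` reaches every recipient of `c`. The rate-`t` contents
of the three two-recipient messages can also carry two common messages of rate `t`, as the parts
`s₀`, `s₁` and `s₀ + s₁`. Where the rates involved are positive, each trade is a feasible direction,
so a normal has nonpositive product with it; together with nonnegativity this is membership in
`Hstar3` (`exists_mem_Hstar3_of_normal`). Where some rates vanish, a normal need not lie in
`Hstar3`. `exists_separating_mem_Hstar3` still separates every outside point by an element of
`Hstar3`: it works near a point of maximal support and extends the normal from the messages that can
have positive rate. Strict separation from a compact set survives small changes of the weight, so
weights dense in `Hstar3` up to scaling suffice, and a limit of normalised separators gives the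
normals at boundary points.

Conversely, for each positive `α` in `Hstar3` there is a channel whose region is, up to relative
error, the simplex `α ⬝ᵥ R ≤ L`. In each use the channel `linkChannel` sends a block over one of
seven links, with about `L / α I` bits on link `I`. Using only one link gives the corners of the
simplex. The upper bound `linkChannel_dotProduct_le` says that coding across links gains nothing for
weights in `Hstar3`: the cone is generated by fifteen vectors (`NonnegOnRays.nonneg`), and for each
of them the bound follows from submodularity of entropy (`nonnegOnRays_of_submodular`). Any weight
cutting off a point just beyond the centre of the large facet must be nearly proportional to `α`. -/

open Filter Topology

/-! ### Operations on codes: recoding, juxtaposition, and a counting bound. -/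

namespace BroadcastChannel

/-- With the messages `w` sent and the outputs `y` received, some message is not decoded
correctly. -/
def Misdecodes {Y : Fin 3 → Type} {ι : Type} {M : Fin 7 → Type}
    (dec : ∀ (i : Fin 3) (I : Fin 7), i ∈ recipients I → (ι → Y i) → M I)
    (w : ∀ I, M I) (y : ι → ∀ i, Y i) : Prop :=
  ∃ (i : Fin 3) (I : Fin 7) (h : i ∈ recipients I), dec i I h (fun t => y t i) ≠ w I

open Classical in
/-- The probability that the message vector `w` is not decoded correctly, for a code whose uses of
the channel are indexed by `ι` and whose message `I` takes its values in the type `M I`. -/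
noncomputable def errAt (ch : BroadcastChannel) {ι : Type} [Fintype ι] {M : Fin 7 → Type}
    (enc : (∀ I, M I) → ι → ch.X)
    (dec : ∀ (i : Fin 3) (I : Fin 7), i ∈ recipients I → (ι → ch.Y i) → M I)
    (w : ∀ I, M I) : ℝ :=
  ∑ y : ι → ∀ i, ch.Y i,
    if Misdecodes dec w y then ∏ t, ch.p (enc w t) (y t) else 0

open Classical in
theorem errAt_eq (ch : BroadcastChannel) {ι : Type} [Fintype ι] [hι : DecidableEq ι]
    {M : Fin 7 → Type} (enc : (∀ I, M I) → ι → ch.X)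
    (dec : ∀ (i : Fin 3) (I : Fin 7), i ∈ recipients I → (ι → ch.Y i) → M I)
    (w : ∀ I, M I) :
    ch.errAt enc dec w = ∑ y : ι → ∀ i, ch.Y i,
      if Misdecodes dec w y then ∏ t, ch.p (enc w t) (y t) else 0 := by
  obtain rfl : hι = fun a b => Classical.propDecidable (a = b) := Subsingleton.elim _ _
  rfl

/-- There is a code with message types `M` and average error probability at most `ε`. -/
def Feasible (ch : BroadcastChannel) (ι : Type) [Fintype ι] (M : Fin 7 → Type)
    [∀ I, Fintype (M I)] (ε : ℝ) : Prop :=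
  ∃ (enc : (∀ I, M I) → ι → ch.X)
    (dec : ∀ (i : Fin 3) (I : Fin 7), i ∈ recipients I → (ι → ch.Y i) → M I),
    ∑ w, ch.errAt enc dec w ≤ ε * Fintype.card (∀ I, M I)

/-- There is an encoding of `M'` into `M` with which each receiver can recover its messages in `M'`
from those in `M` that are intended for it. -/
def Recodes (M' M : Fin 7 → Type) : Prop :=
  ∃ φ : (∀ I, M' I) → ∀ I, M I, ∀ (i : Fin 3) (w w' : ∀ I, M' I),
    (∀ J, i ∈ recipients J → φ w J = φ w' J) → ∀ I, i ∈ recipients I → w I = w' I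

variable {ch : BroadcastChannel}

theorem sum_prod_p {ι : Type} [Fintype ι] [DecidableEq ι] (x : ι → ch.X) :
    ∑ y : ι → ∀ i, ch.Y i, ∏ t, ch.p (x t) (y t) = 1 := by
  classical
  have := (Finset.prod_univ_sum (fun _ : ι => (Finset.univ : Finset (∀ i, ch.Y i)))
    (fun t y => ch.p (x t) y)).symm
  rw [Fintype.piFinset_univ] at this
  convert this using 1
  simp [ch.p_sum]

theorem prod_p_nonneg {ι : Type} [Fintype ι] (x : ι → ch.X) (y : ι → ∀ i, ch.Y i) :
    0 ≤ ∏ t, ch.p (x t) (y t) :=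
  Finset.prod_nonneg fun _ _ => ch.p_nonneg _ _

theorem errAt_nonneg {ι : Type} [Fintype ι] {M : Fin 7 → Type}
    (enc : (∀ I, M I) → ι → ch.X)
    (dec : ∀ (i : Fin 3) (I : Fin 7), i ∈ recipients I → (ι → ch.Y i) → M I)
    (w : ∀ I, M I) : 0 ≤ ch.errAt enc dec w := by
  classical
  refine Finset.sum_nonneg fun y _ => ?_
  split_ifs
  · exact prod_p_nonneg _ _
  · exact le_rfl

/-- Recoding the messages of a code, with a random shift that makes all message vectors of the
given code equally likely. -/
theorem Feasible.recode {ι : Type} [Fintype ι] {M M' : Fin 7 → Type} [∀ I, Fintype (M I)]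
    [∀ I, Fintype (M' I)] [∀ I, Nonempty (M I)] [∀ I, Nonempty (M' I)] {ε : ℝ}
    (h : ch.Feasible ι M ε) (hr : Recodes M' M) : ch.Feasible ι M' ε := by
  classical
  obtain ⟨enc, dec, he⟩ := h
  obtain ⟨φ, hφ⟩ := hr
  have hdec : ∀ i I, i ∈ recipients I → ∃ ψ : (∀ J, i ∈ recipients J → M J) → M' I,
      ∀ w, ψ (fun J _ => φ w J) = w I := by
    intro i I hI
    refine ⟨fun v => if hv : ∃ w, ∀ J hJ, φ w J = v J hJ then hv.choose I
      else Classical.arbitrary _, fun w => ?_⟩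
    have hv : ∃ w', ∀ J (_ : i ∈ recipients J), φ w' J = φ w J := ⟨w, fun _ _ => rfl⟩
    refine (dif_pos hv).trans ?_
    exact hφ i _ _ hv.choose_spec I hI
  choose ψ hψ using hdec
  have : ∀ I, NeZero (Fintype.card (M I)) := fun I => ⟨Fintype.card_ne_zero⟩
  have e : ∀ I, M I ≃ Fin (Fintype.card (M I)) := fun I => Fintype.equivFin _
  -- Any group structure will do. For fixed `w`, the vector `φ w + u` runs through all message
  -- vectors as `u` does, although the image of `φ` alone might consist of badly decoded ones.
  let : ∀ I, AddCommGroup (M I) := fun I =>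
    @Equiv.addCommGroup _ _ (e I) (inferInstance : AddCommGroup (Fin (Fintype.card (M I))))
  let encu : (∀ I, M I) → (∀ I, M' I) → ι → ch.X := fun u w => enc (φ w + u)
  let decu : (∀ I, M I) → ∀ (i : Fin 3) (I : Fin 7), i ∈ recipients I → (ι → ch.Y i) → M' I :=
    fun u i I hI y => ψ i I hI (fun J hJ => dec i J hJ y - u J)
  have key : ∀ u w, ch.errAt (encu u) (decu u) w ≤ ch.errAt enc dec (φ w + u) := by
    intro u w
    refine Finset.sum_le_sum fun y _ => ?_
    by_cases hy : Misdecodes dec (φ w + u) y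
    · rw [if_pos hy]
      split_ifs
      · exact le_rfl
      · exact prod_p_nonneg _ _
    · rw [if_neg hy, if_neg]
      unfold Misdecodes at hy
      push Not at hy
      rintro ⟨i, I, hI, hne⟩
      apply hne
      rw [← hψ i I hI w]
      simp only [decu]
      congr 1
      funext J hJ
      rw [hy i J hJ]
      simp
  have tot : ∑ u : ∀ I, M I, ∑ w, ch.errAt (encu u) (decu u) w ≤
      ∑ _u : ∀ I, M I, ε * Fintype.card (∀ I, M' I) := by
    rw [Finset.sum_comm]
    calc ∑ w, ∑ u, ch.errAt (encu u) (decu u) w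
        ≤ ∑ w : ∀ I, M' I, ∑ u, ch.errAt enc dec (φ w + u) :=
          Finset.sum_le_sum fun w _ => Finset.sum_le_sum fun u _ => key u w
      _ = ∑ _w : ∀ I, M' I, ∑ u, ch.errAt enc dec u := by
          refine Finset.sum_congr rfl fun w _ => ?_
          exact Fintype.sum_equiv (Equiv.addLeft (φ w)) _ _ fun u => rfl
      _ ≤ ∑ _w : ∀ I, M' I, ε * Fintype.card (∀ I, M I) :=
          Finset.sum_le_sum fun w _ => he
      _ = _ := by
          simp only [Finset.sum_const, nsmul_eq_mul, Finset.card_univ]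
          ring
  obtain ⟨u, -, hu⟩ := Finset.exists_le_of_sum_le Finset.univ_nonempty tot
  exact ⟨encu u, decu u, hu⟩

theorem Feasible.mono {ι : Type} [Fintype ι] {M : Fin 7 → Type} [∀ I, Fintype (M I)]
    {ε ε' : ℝ} (h : ch.Feasible ι M ε) (hε : ε ≤ ε') : ch.Feasible ι M ε' := by
  obtain ⟨enc, dec, he⟩ := h
  exact ⟨enc, dec, he.trans (by gcongr)⟩

theorem Feasible.reindex {ι κ : Type} [Fintype ι] [Fintype κ] (e : ι ≃ κ)
    {M : Fin 7 → Type} [∀ I, Fintype (M I)] {ε : ℝ} (h : ch.Feasible ι M ε) :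
    ch.Feasible κ M ε := by
  classical
  obtain ⟨enc, dec, he⟩ := h
  refine ⟨fun w t => enc w (e.symm t), fun i I hI y => dec i I hI (fun t => y (e t)),
    le_trans (le_of_eq ?_) he⟩
  refine Finset.sum_congr rfl fun w _ => ?_
  refine (Fintype.sum_equiv (Equiv.arrowCongr e (Equiv.refl _)) _ _ fun y => ?_).symm
  refine if_congr ?_ (Fintype.prod_equiv e _ _ fun t => by simp) rfl
  simp [Misdecodes]

/-- Time sharing. -/
theorem Feasible.prod {ι κ : Type} [Fintype ι] [Fintype κ] {M N : Fin 7 → Type}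
    [∀ I, Fintype (M I)] [∀ I, Fintype (N I)] {ε δ : ℝ} (h : ch.Feasible ι M ε)
    (h' : ch.Feasible κ N δ) : ch.Feasible (ι ⊕ κ) (fun I => M I × N I) (ε + δ) := by
  classical
  obtain ⟨enc, dec, he⟩ := h
  obtain ⟨enc', dec', he'⟩ := h'
  let encp : (∀ I, M I × N I) → ι ⊕ κ → ch.X :=
    fun w => Sum.elim (enc fun I => (w I).1) (enc' fun I => (w I).2)
  let decp : ∀ (i : Fin 3) (I : Fin 7), i ∈ recipients I → (ι ⊕ κ → ch.Y i) → M I × N I :=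
    fun i I hI y => (dec i I hI fun t => y (.inl t), dec' i I hI fun t => y (.inr t))
  have key : ∀ w, ch.errAt encp decp w ≤
      ch.errAt enc dec (fun I => (w I).1) + ch.errAt enc' dec' (fun I => (w I).2) := by
    intro w
    have h1 : ch.errAt enc dec (fun I => (w I).1) = ∑ y : ι → ∀ i, ch.Y i,
        ∑ y' : κ → ∀ i, ch.Y i,
        (if Misdecodes dec (fun I => (w I).1) y then ∏ t, ch.p (enc (fun I => (w I).1) t) (y t) else 0) *
          ∏ t, ch.p (enc' (fun I => (w I).2) t) (y' t) := by
      simp only [← Finset.mul_sum, sum_prod_p, mul_one]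
      rfl
    have h2 : ch.errAt enc' dec' (fun I => (w I).2) = ∑ y : ι → ∀ i, ch.Y i,
        ∑ y' : κ → ∀ i, ch.Y i, (∏ t, ch.p (enc (fun I => (w I).1) t) (y t)) *
        (if Misdecodes dec' (fun I => (w I).2) y' then ∏ t, ch.p (enc' (fun I => (w I).2) t) (y' t) else 0) := by
      simp only [← Finset.mul_sum, ← Finset.sum_mul, sum_prod_p, one_mul]
      rfl
    rw [h1, h2, ← Finset.sum_add_distrib]
    simp only [← Finset.sum_add_distrib]
    rw [← Fintype.sum_prod_type']
    rw [errAt_eq]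
    refine le_trans (le_of_eq (Fintype.sum_equiv
      (Equiv.sumArrowEquivProdArrow ι κ (∀ i, ch.Y i)) _
      (fun y => if Misdecodes dec (fun I => (w I).1) y.1 ∨ Misdecodes dec' (fun I => (w I).2) y.2
        then (∏ t, ch.p (enc (fun I => (w I).1) t) (y.1 t)) *
          ∏ t, ch.p (enc' (fun I => (w I).2) t) (y.2 t) else 0) fun y => ?_)) ?_
    · rw [Fintype.prod_sum_type]
      refine if_congr ?_ rfl rfl
      simp only [Misdecodes, ← exists_or]
      refine exists_congr fun i => exists_congr fun I => exists_congr fun hI => ?_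
      rw [← not_and_or, not_iff_not]
      exact Prod.ext_iff
    · refine Finset.sum_le_sum fun y _ => ?_
      have n1 := prod_p_nonneg (enc fun I => (w I).1) y.1
      have n2 := prod_p_nonneg (enc' fun I => (w I).2) y.2
      have n3 := mul_nonneg n1 n2
      by_cases b : Misdecodes dec (fun I => (w I).1) y.1 <;>
        by_cases d : Misdecodes dec' (fun I => (w I).2) y.2 <;> simp [b, d, n3]
  refine ⟨encp, decp, (Finset.sum_le_sum fun w _ => key w).trans ?_⟩
  let e : (∀ I, M I × N I) ≃ (∀ I, M I) × (∀ I, N I) :=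
    ⟨fun w => (fun I => (w I).1, fun I => (w I).2), fun v I => (v.1 I, v.2 I),
      fun _ => rfl, fun _ => rfl⟩
  refine le_trans (le_of_eq (Fintype.sum_equiv e _
    (fun v => ch.errAt enc dec v.1 + ch.errAt enc' dec' v.2) (fun w => rfl))) ?_
  rw [Fintype.card_congr e, Fintype.card_prod, Fintype.sum_prod_type]
  simp only [Finset.sum_add_distrib, Finset.sum_const, ← Finset.mul_sum, nsmul_eq_mul,
    Finset.card_univ]
  push_cast
  have c1 : (0 : ℝ) ≤ Fintype.card (∀ I, M I) := Nat.cast_nonneg _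
  have c2 : (0 : ℝ) ≤ Fintype.card (∀ I, N I) := Nat.cast_nonneg _
  nlinarith [mul_le_mul_of_nonneg_left he c2, mul_le_mul_of_nonneg_left he' c1]

/-- The success probability is at most the number of output blocks over the number of messages. -/
theorem Feasible.card_mul_le {ι : Type} [Fintype ι] [DecidableEq ι] {M : Fin 7 → Type}
    [∀ I, Fintype (M I)]
    [∀ I, Nonempty (M I)] {ε : ℝ} (h : ch.Feasible ι M ε) {i : Fin 3} {I : Fin 7}
    (hI : i ∈ recipients I) :
    (1 - ε) * Fintype.card (M I) ≤ (Fintype.card (ch.Y i) : ℝ) ^ Fintype.card ι := by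
  classical
  obtain ⟨enc, dec, he⟩ := h
  -- The success probability is at most that of receiver `i` seeing some block `η` that decodes to
  -- `w I`, and each `η` has probability at most `1`. Summed over `w`, each `η` counts only for the
  -- single value of `w I` it decodes to.
  have hw : ∀ w, 1 - ch.errAt enc dec w ≤ ∑ η : ι → ch.Y i, if dec i I hI η = w I then 1 else 0 := by
    intro w
    calc 1 - ch.errAt enc dec w
        ≤ ∑ y : ι → ∀ i, ch.Y i, if dec i I hI (fun t => y t i) = w I
            then ∏ t, ch.p (enc w t) (y t) else 0 := by
          rw [← sum_prod_p (enc w), sub_le_iff_le_add]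
          rw [errAt_eq, ← Finset.sum_add_distrib]
          refine Finset.sum_le_sum fun y _ => ?_
          have := prod_p_nonneg (enc w) y
          split_ifs with a b b
          · linarith
          · linarith
          · linarith
          · exact absurd ⟨i, I, hI, a⟩ b
      _ = ∑ η : ι → ch.Y i, ∑ y : ι → ∀ i, ch.Y i, if (fun t => y t i) = η then
            (if dec i I hI η = w I then ∏ t, ch.p (enc w t) (y t) else 0) else 0 := by
          rw [Finset.sum_comm]
          simp
      _ ≤ _ := by
          refine Finset.sum_le_sum fun η _ => ?_
          split_ifs with hη
          · rw [← sum_prod_p (enc w)]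
            refine Finset.sum_le_sum fun y _ => ?_
            split_ifs
            · exact le_rfl
            · exact prod_p_nonneg _ _
          · simp
  let e := Equiv.piSplitAt I M
  have hc : (Fintype.card (∀ J, M J) : ℝ) =
      Fintype.card (M I) * Fintype.card (∀ J : {J // J ≠ I}, M J) := by
    rw [Fintype.card_congr e, Fintype.card_prod]
    push_cast
    rfl
  have h1 : ∑ w : ∀ J, M J, (1 - ch.errAt enc dec w) ≤
      (Fintype.card (ι → ch.Y i) : ℝ) * Fintype.card (∀ J : {J // J ≠ I}, M J) := by
    refine (Finset.sum_le_sum fun w _ => hw w).trans (le_of_eq ?_)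
    rw [Finset.sum_comm]
    have : ∀ η : ι → ch.Y i, (∑ w : ∀ J, M J, if dec i I hI η = w I then (1 : ℝ) else 0) =
        Fintype.card (∀ J : {J // J ≠ I}, M J) := by
      intro η
      refine (Fintype.sum_equiv e _
        (fun v => if dec i I hI η = v.1 then (1 : ℝ) else 0) (fun w => rfl)).trans ?_
      rw [Fintype.sum_prod_type, Finset.sum_comm]
      simp
    simp only [this, Finset.sum_const, nsmul_eq_mul, Finset.card_univ]
  rw [Finset.sum_sub_distrib] at h1
  simp only [Finset.sum_const, nsmul_eq_mul, Finset.card_univ, mul_one] at h1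
  have hpos : (0 : ℝ) < Fintype.card (∀ J : {J // J ≠ I}, M J) :=
    Nat.cast_pos.mpr Fintype.card_pos
  have h2 : (Fintype.card (ι → ch.Y i) : ℝ) = (Fintype.card (ch.Y i) : ℝ) ^ Fintype.card ι := by
    simp
  rw [hc] at h1 he
  rw [← h2]
  refine le_of_mul_le_mul_right ?_ hpos
  linarith

end BroadcastChannel

/-! ### Rates: the capacity region is compact, convex and closed under decreasing rates. -/

namespace BroadcastChannel

variable {ch : BroadcastChannel}

/-- The number of messages that `u` bits can represent. -/
noncomputable def bitCount (u : ℝ) : ℕ := ⌊(2 : ℝ) ^ u⌋₊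

theorem one_le_bitCount {u : ℝ} (hu : 0 ≤ u) : 1 ≤ bitCount u :=
  Nat.le_floor (by simpa using Real.one_le_rpow (by norm_num : (1 : ℝ) ≤ 2) hu)

theorem bitCount_mono {u v : ℝ} (h : u ≤ v) : bitCount u ≤ bitCount v :=
  Nat.floor_mono (Real.rpow_le_rpow_of_exponent_le (by norm_num) h)

theorem bitCount_le (u : ℝ) : (bitCount u : ℝ) ≤ 2 ^ u :=
  Nat.floor_le (by positivity)

theorem le_bitCount {u : ℝ} (hu : 0 ≤ u) : (2 : ℝ) ^ (u - 1) ≤ bitCount u := by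
  have h1 : (2 : ℝ) ^ u < bitCount u + 1 := Nat.lt_floor_add_one _
  have h2 : (1 : ℝ) ≤ bitCount u := by exact_mod_cast one_le_bitCount hu
  rw [Real.rpow_sub_one (by norm_num)]
  linarith

theorem bitCount_mul_le (u v : ℝ) : bitCount u * bitCount v ≤ bitCount (u + v) := by
  refine Nat.le_floor ?_
  push_cast
  rw [Real.rpow_add (by norm_num)]
  exact mul_le_mul (bitCount_le u) (bitCount_le v) (Nat.cast_nonneg _) (by positivity)

/-- Rounding down costs at most one bit in each of the `k + 1` factors. The alternative `0` covers
truncated rates, for which a single message value is enough. -/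
theorem bitCount_le_mul_pow {u v z : ℝ} (hu : 0 ≤ u) (hv : 0 ≤ v) (k : ℕ)
    (hz : z ≤ max (u + k * v - (k + 1)) 0) : bitCount z ≤ bitCount u * bitCount v ^ k := by
  rcases le_max_iff.1 hz with h | h
  · have : (bitCount z : ℝ) ≤ bitCount u * (bitCount v : ℝ) ^ k :=
      calc (bitCount z : ℝ) ≤ 2 ^ z := bitCount_le z
        _ ≤ 2 ^ ((u - 1) + (v - 1) * k) :=
          Real.rpow_le_rpow_of_exponent_le (by norm_num) (by linarith)
        _ = 2 ^ (u - 1) * ((2 : ℝ) ^ (v - 1)) ^ k := by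
          rw [Real.rpow_add (by norm_num), Real.rpow_mul (by norm_num), Real.rpow_natCast]
        _ ≤ _ := by
          gcongr
          · exact le_bitCount hu
          · exact le_bitCount hv
    exact_mod_cast this
  · have h0 : bitCount z ≤ 1 := by
      have := bitCount_mono h
      simpa [bitCount] using this
    have := Nat.mul_le_mul (one_le_bitCount hu) (Nat.pow_le_pow_left (one_le_bitCount hv) k)
    rw [one_pow] at this
    exact h0.trans this

/-- There is a code of length `n` with `2 ^ (n R I)` values of the message `I`. -/
def FeasibleRate (ch : BroadcastChannel) (R : Fin 7 → ℝ) (n : ℕ) (ε : ℝ) : Prop :=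
  ch.Feasible (Fin n) (fun I => Fin (bitCount (n * R I))) ε

theorem nonempty_fin_bitCount {R : Fin 7 → ℝ} (hR : ∀ I, 0 ≤ R I) (n : ℕ) (I : Fin 7) :
    Nonempty (Fin (bitCount (n * R I))) :=
  ⟨⟨0, one_le_bitCount (mul_nonneg n.cast_nonneg (hR I))⟩⟩

theorem Code.errorProb_eq {n : ℕ} {M : Fin 7 → ℕ} (c : Code ch n M) :
    c.errorProb = (∑ w, ch.errAt c.enc c.dec w) / ∏ I, (M I : ℝ) := by
  unfold Code.errorProb
  simp only [errAt_eq]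
  rfl

theorem Code.errorProb_nonneg {n : ℕ} {M : Fin 7 → ℕ} (c : Code ch n M) : 0 ≤ c.errorProb := by
  rw [c.errorProb_eq]
  exact div_nonneg (Finset.sum_nonneg fun w _ => errAt_nonneg _ _ _)
    (Finset.prod_nonneg fun _ _ => Nat.cast_nonneg _)

theorem feasibleRate_iff {R : Fin 7 → ℝ} (hR : ∀ I, 0 ≤ R I) {n : ℕ} {ε : ℝ} :
    ch.FeasibleRate R n ε ↔ ∃ c : Code ch n (messageCount R n), c.errorProb ≤ ε := by
  have hpos : (0 : ℝ) < ∏ I, (messageCount R n I : ℝ) :=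
    Finset.prod_pos fun I _ => Nat.cast_pos.2
      (one_le_bitCount (mul_nonneg n.cast_nonneg (hR I)))
  have hcard : (Fintype.card (∀ I, Fin (bitCount (n * R I))) : ℝ) =
      ∏ I, (messageCount R n I : ℝ) := by
    rw [Fintype.card_pi, Nat.cast_prod]
    exact Finset.prod_congr rfl fun I _ => by rw [Fintype.card_fin]; rfl
  constructor
  · rintro ⟨enc, dec, h⟩
    refine ⟨⟨enc, dec⟩, ?_⟩
    rw [Code.errorProb_eq, div_le_iff₀ hpos, ← hcard]
    exact h
  · rintro ⟨c, h⟩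
    rw [Code.errorProb_eq, div_le_iff₀ hpos, ← hcard] at h
    exact ⟨c.enc, c.dec, h⟩

theorem achievable_iff {R : Fin 7 → ℝ} :
    ch.Achievable R ↔ (∀ I, 0 ≤ R I) ∧ ∀ ε > 0, ∀ᶠ n in atTop, ch.FeasibleRate R n ε := by
  constructor
  · rintro ⟨hR, c, hc⟩
    refine ⟨hR, fun ε hε => ?_⟩
    filter_upwards [hc.eventually (ge_mem_nhds hε)] with n hn
    exact (feasibleRate_iff hR).2 ⟨c n, hn⟩
  · rintro ⟨hR, h⟩
    refine ⟨hR, ?_⟩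
    have hne : ∀ n, Nonempty (Code ch n (messageCount R n)) := fun n => by
      have := nonempty_fin_bitCount hR n
      exact ⟨⟨fun _ _ => Classical.arbitrary _, fun _ I _ _ => (this I).some⟩⟩
    have hbdd : ∀ n, BddBelow (Set.range fun c : Code ch n (messageCount R n) => c.errorProb) :=
      fun n => ⟨0, by rintro _ ⟨c, rfl⟩; exact c.errorProb_nonneg⟩
    -- One sequence has to serve all `ε` at once: for each `n` take a code within `1 / (n + 1)` of
    -- the least error probability.
    have hex : ∀ n : ℕ, ∃ c : Code ch n (messageCount R n),
        c.errorProb < (⨅ c : Code ch n (messageCount R n), c.errorProb) + 1 / ((n : ℝ) + 1) :=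
      fun n => exists_lt_of_ciInf_lt (lt_add_of_pos_right _ (by positivity))
    choose c hc using hex
    refine ⟨c, tendsto_order.2 ⟨fun a ha => Eventually.of_forall fun n =>
      ha.trans_le (c n).errorProb_nonneg, fun a ha => ?_⟩⟩
    have h1 : ∀ᶠ n : ℕ in atTop, 1 / ((n : ℝ) + 1) < a / 2 :=
      (tendsto_one_div_add_atTop_nhds_zero_nat).eventually (gt_mem_nhds (half_pos ha))
    filter_upwards [h (a / 2) (half_pos ha), h1] with n hn hn1
    obtain ⟨c', hc'⟩ := (feasibleRate_iff hR).1 hn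
    have := ciInf_le (hbdd n) c'
    have := hc n
    linarith

/-- The slack `δ` yields `n δ` spare bits, which absorb any bounded number of bits lost to rounding.
-/
theorem mem_capacityRegion_of_forall_pos {R : Fin 7 → ℝ} (hR : ∀ I, 0 ≤ R I)
    (h : ∀ δ > 0, ch.Achievable fun I => max (R I - δ) 0) : R ∈ ch.capacityRegion := by
  have hc : Tendsto (fun δ : ℝ => fun I => max (R I - δ) 0) (𝓝[>] 0) (𝓝 R) := by
    have h1 : Continuous (fun δ : ℝ => fun I => max (R I - δ) 0) := by fun_prop
    have h2 := (h1.tendsto 0).mono_left (nhdsWithin_le_nhds (s := Set.Ioi 0))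
    convert h2 using 2
    funext I
    simp [hR I]
  exact mem_closure_of_tendsto hc (eventually_nhdsWithin_of_forall fun δ hδ => h δ hδ)

theorem nonneg_of_mem_capacityRegion {R : Fin 7 → ℝ} (h : R ∈ ch.capacityRegion) (I : Fin 7) :
    0 ≤ R I := by
  have hcl : IsClosed {R : Fin 7 → ℝ | 0 ≤ R I} :=
    isClosed_le continuous_const (continuous_apply I)
  exact closure_minimal (fun R hR => hR.1 I) hcl h

theorem Recodes.of_card_le {M M' : Fin 7 → Type} [∀ I, Fintype (M I)] [∀ I, Fintype (M' I)]
    (h : ∀ I, Fintype.card (M' I) ≤ Fintype.card (M I)) : Recodes M' M := by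
  have := fun I => Function.Embedding.nonempty_of_card_le (h I)
  exact ⟨fun w I => (this I).some (w I), fun i w w' h I hI => (this I).some.injective (h I hI)⟩

theorem Achievable.anti {R R' : Fin 7 → ℝ} (h : ch.Achievable R) (h0 : ∀ I, 0 ≤ R' I)
    (hle : ∀ I, R' I ≤ R I) : ch.Achievable R' := by
  rw [achievable_iff] at h ⊢
  refine ⟨h0, fun ε hε => ?_⟩
  filter_upwards [h.2 ε hε] with n hn
  have := nonempty_fin_bitCount h.1 n
  have := nonempty_fin_bitCount h0 n
  refine Feasible.recode hn (Recodes.of_card_le fun I => ?_)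
  simpa using bitCount_mono (mul_le_mul_of_nonneg_left (hle I) n.cast_nonneg)

theorem capacityRegion_anti {R R' : Fin 7 → ℝ} (h : R ∈ ch.capacityRegion) (h0 : ∀ I, 0 ≤ R' I)
    (hle : ∀ I, R' I ≤ R I) : R' ∈ ch.capacityRegion := by
  have hc : Continuous fun r : Fin 7 → ℝ => fun I => min (r I) (R' I) := by fun_prop
  have := map_mem_closure hc h (t := {R | ch.Achievable R}) fun r hr =>
    Achievable.anti hr (fun I => le_min (hr.1 I) (h0 I)) fun I => min_le_left _ _
  have he : (fun I => min (R I) (R' I)) = R' := funext fun I => min_eq_right (hle I)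
  rwa [he] at this

theorem achievable_zero : ch.Achievable 0 := by
  rw [achievable_iff]
  refine ⟨fun I => le_rfl, fun ε hε => Eventually.of_forall fun n => ?_⟩
  have h1 : bitCount (n * (0 : Fin 7 → ℝ) 0) = 1 := by simp [bitCount]
  have : ∀ I, Subsingleton (Fin (bitCount (n * (0 : Fin 7 → ℝ) I))) := fun I => by
    have : bitCount (n * (0 : Fin 7 → ℝ) I) = 1 := h1
    rw [this]
    infer_instance
  have hne := nonempty_fin_bitCount (R := 0) (fun I => le_rfl) n
  refine ⟨fun _ _ => Classical.arbitrary _, fun _ I _ _ => (hne I).some, ?_⟩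
  refine le_trans (le_of_eq ?_) (mul_nonneg hε.le (Nat.cast_nonneg _))
  refine Finset.sum_eq_zero fun w _ => Finset.sum_eq_zero fun y _ => if_neg ?_
  rintro ⟨i, I, hI, hne⟩
  exact hne (Subsingleton.elim _ _)

theorem zero_mem_capacityRegion : 0 ∈ ch.capacityRegion := subset_closure achievable_zero

theorem exists_capacityRegion_le (ch : BroadcastChannel) :
    ∃ B : ℝ, ∀ R ∈ ch.capacityRegion, ∀ I, R I ≤ B := by
  let K : ℕ := ∑ i, Fintype.card (ch.Y i)
  -- One bit is lost to success probability `1 / 2` and one to rounding, so `2 ^ (n R I - 2) ≤ 2 ^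
  -- (K n)`; then use `n ≥ 1`.
  refine ⟨K + 2, fun R hR I => ?_⟩
  have hcl : IsClosed {R : Fin 7 → ℝ | R I ≤ K + 2} :=
    isClosed_le (continuous_apply I) continuous_const
  refine closure_minimal (fun r hr => ?_) hcl hR
  rw [Set.mem_ofPred_eq, achievable_iff] at hr
  obtain ⟨n, hn, hn1⟩ := ((hr.2 (1 / 2) (by norm_num)).and (eventually_ge_atTop 1)).exists
  have := nonempty_fin_bitCount hr.1 n
  obtain ⟨i, hi⟩ : (recipients I).Nonempty := by
    clear hcl; revert I; decide
  have h1 := Feasible.card_mul_le hn hi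
  simp only [Fintype.card_fin] at h1
  have h2 := le_bitCount (mul_nonneg n.cast_nonneg (hr.1 I))
  have h3 : (Fintype.card (ch.Y i) : ℝ) ≤ 2 ^ K := by
    have : Fintype.card (ch.Y i) ≤ K :=
      Finset.single_le_sum (f := fun i => Fintype.card (ch.Y i)) (fun _ _ => Nat.zero_le _)
        (Finset.mem_univ i)
    exact_mod_cast this.trans Nat.lt_two_pow_self.le
  have h4 : (Fintype.card (ch.Y i) : ℝ) ^ n ≤ ((2 : ℝ) ^ K) ^ n :=
    pow_le_pow_left₀ (Nat.cast_nonneg _) h3 n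
  have h5 : (2 : ℝ) ^ (n * r I - 1 - 1) ≤ 2 ^ ((K * n : ℕ) : ℝ) := by
    rw [Real.rpow_natCast, pow_mul, Real.rpow_sub_one (by norm_num)]
    linarith
  rw [Real.rpow_le_rpow_left_iff (by norm_num)] at h5
  push_cast at h5
  have hn1' : (1 : ℝ) ≤ n := by exact_mod_cast hn1
  show r I ≤ K + 2
  by_contra! hcon
  nlinarith

theorem isCompact_capacityRegion (ch : BroadcastChannel) : IsCompact ch.capacityRegion := by
  obtain ⟨B, hB⟩ := ch.exists_capacityRegion_le
  refine (isCompact_Icc (a := (0 : Fin 7 → ℝ)) (b := fun _ => B)).of_isClosed_subset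
    isClosed_closure fun R hR => ⟨fun I => nonneg_of_mem_capacityRegion hR I, fun I => hB R hR I⟩

/-- Time sharing between two achievable rate vectors. -/
theorem Achievable.timeShare {R R' : Fin 7 → ℝ} (h : ch.Achievable R) (h' : ch.Achievable R')
    {a b : ℝ} (ha : 0 < a) (hb : 0 < b) (hab : a + b = 1) : a • R + b • R' ∈ ch.capacityRegion := by
  have hn0 : ∀ I, 0 ≤ (a • R + b • R') I := fun I => by
    have := mul_nonneg ha.le (h.1 I)
    have := mul_nonneg hb.le (h'.1 I)
    simpa using by linarith
  refine mem_capacityRegion_of_forall_pos hn0 fun δ hδ => ?_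
  rw [achievable_iff] at h h' ⊢
  refine ⟨fun I => le_max_right _ _, fun ε hε => ?_⟩
  have t1 : Tendsto (fun n : ℕ => ⌊a * n⌋₊) atTop atTop :=
    tendsto_nat_floor_atTop.comp (tendsto_natCast_atTop_atTop.const_mul_atTop ha)
  have hle : ∀ n : ℕ, ⌊a * n⌋₊ ≤ n := fun n => by
    have : ⌊a * n⌋₊ ≤ ⌊(n : ℝ)⌋₊ := Nat.floor_mono (by nlinarith [(n.cast_nonneg : (0 : ℝ) ≤ n)])
    simpa using this
  have t2 : Tendsto (fun n : ℕ => n - ⌊a * n⌋₊) atTop atTop := by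
    rw [← tendsto_natCast_atTop_iff (R := ℝ)]
    refine tendsto_atTop_mono (fun n => ?_)
      ((tendsto_natCast_atTop_atTop (R := ℝ)).const_mul_atTop hb)
    rw [Nat.cast_sub (hle n)]
    have := Nat.floor_le (mul_nonneg ha.le (n.cast_nonneg : (0 : ℝ) ≤ n))
    nlinarith
  -- Rounding `a n` down loses at most one use at rate `R I`, and two message counts are rounded.
  have t3 : ∀ᶠ n : ℕ in atTop, ∀ I, (R I + 2) / δ ≤ n :=
    eventually_all.2 fun I => (tendsto_natCast_atTop_atTop (R := ℝ)).eventually_ge_atTop _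
  filter_upwards [t1.eventually (h.2 (ε / 2) (half_pos hε)),
    t2.eventually (h'.2 (ε / 2) (half_pos hε)), t3] with n hn hn' hn3
  set m := ⌊a * n⌋₊ with hm
  have n1 := nonempty_fin_bitCount h.1 m
  have n2 := nonempty_fin_bitCount h'.1 (n - m)
  have n3 := nonempty_fin_bitCount (R := fun I => max ((a • R + b • R') I - δ) 0)
    (fun I => le_max_right _ _) n
  have := (Feasible.prod hn hn').mono (add_halves ε).le
  have := this.reindex (finSumFinEquiv.trans (finCongr (Nat.add_sub_cancel' (hle n))))
  refine this.recode (Recodes.of_card_le fun I => ?_)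
  simp only [Fintype.card_fin, Fintype.card_prod]
  have h0 := h.1 I
  have h0' := h'.1 I
  have hb := bitCount_le_mul_pow (mul_nonneg m.cast_nonneg h0)
    (mul_nonneg (n - m).cast_nonneg h0') 1
    (z := n * max ((a • R + b • R') I - δ) 0) ?_
  · simpa using hb
  have hm1 : (m : ℝ) ≤ a * n := Nat.floor_le (by positivity)
  have hm2 : a * n < m + 1 := Nat.lt_floor_add_one _
  have hn4 := hn3 I
  rw [div_le_iff₀ hδ] at hn4
  rw [Nat.cast_sub (hle n), mul_max_of_nonneg _ _ n.cast_nonneg, mul_zero]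
  refine max_le_max_right _ ?_
  obtain rfl : b = 1 - a := by linarith
  simp only [Pi.add_apply, Pi.smul_apply, smul_eq_mul, Nat.cast_one, ← hm]
  linarith [mul_le_mul_of_nonneg_right hm1 h0', mul_le_mul_of_nonneg_right hm2.le h0]

theorem convex_capacityRegion (ch : BroadcastChannel) : Convex ℝ ch.capacityRegion := by
  rw [convex_iff_forall_pos]
  intro R hR R' hR' a b ha hb hab
  have hc : Continuous (Function.uncurry fun r r' : Fin 7 → ℝ => a • r + b • r') := by
    unfold Function.uncurry; fun_prop
  have := map_mem_closure₂ hc hR hR' (u := ch.capacityRegion) fun r hr r' hr' =>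
    Achievable.timeShare hr hr' ha hb hab
  rwa [capacityRegion, closure_closure] at this

end BroadcastChannel

/-! ### Trading rates of some messages for the rate of another. -/

namespace BroadcastChannel

variable {ch : BroadcastChannel}

/-- Part of the message `c` is sent over the messages in `D`, by a code `κ` with which each
recipient of `c` can recover it. -/
theorem Recodes.of_code {M M' : Fin 7 → Type} [∀ I, Fintype (M I)] [∀ I, Fintype (M' I)]
    {K B : Type} [Fintype K] [Fintype B] (D : Finset (Fin 7)) {c : Fin 7} (hc : c ∉ D)
    (κ : Fin 7 → K → B)
    (hκ : ∀ i ∈ recipients c, ∀ s s', (∀ J ∈ D, i ∈ recipients J → κ J s = κ J s') → s = s')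
    (h : ∀ I, Fintype.card (M' I) ≤ Fintype.card (M I) ∨ I = c)
    (hD : ∀ J ∈ D, Fintype.card (M' J) * Fintype.card B ≤ Fintype.card (M J))
    (hM : Fintype.card (M' c) ≤ Fintype.card (M c) * Fintype.card K) : Recodes M' M := by
  classical
  have e1 : ∀ I, I ≠ c → Nonempty (M' I ↪ M I) := fun I hI =>
    Function.Embedding.nonempty_of_card_le ((h I).resolve_right hI)
  have e2 : ∀ J, J ∈ D → Nonempty (M' J × B ↪ M J) := fun J hJ =>
    Function.Embedding.nonempty_of_card_le (by rw [Fintype.card_prod]; exact hD J hJ)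
  obtain ⟨g⟩ : Nonempty (M' c ↪ M c × K) :=
    Function.Embedding.nonempty_of_card_le (by rw [Fintype.card_prod]; exact hM)
  let φ : (∀ I, M' I) → ∀ I, M I := fun w I =>
    if hI : I = c then hI ▸ (g (w c)).1
    else if hD : I ∈ D then (e2 I hD).some (w I, κ I (g (w c)).2)
    else (e1 I hI).some (w I)
  have hφc : ∀ w, φ w c = (g (w c)).1 := fun w => by simp [φ]
  have hφD : ∀ w J (hJ : J ∈ D), φ w J = (e2 J hJ).some (w J, κ J (g (w c)).2) := fun w J hJ => by
    have : J ≠ c := fun h => hc (h ▸ hJ)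
    simp [φ, this, hJ]
  refine ⟨φ, fun i w w' hw I hI => ?_⟩
  by_cases hIc : I = c
  · subst hIc
    apply g.injective
    refine Prod.ext ?_ ?_
    · rw [← hφc, ← hφc, hw I hI]
    · refine hκ i hI _ _ fun J hJ hiJ => ?_
      have := hw J hiJ
      rw [hφD w J hJ, hφD w' J hJ] at this
      exact (Prod.ext_iff.1 ((e2 J hJ).some.injective this)).2
  · by_cases hID : I ∈ D
    · have := hw I hI
      rw [hφD w I hID, hφD w' I hID] at this
      exact (Prod.ext_iff.1 ((e2 I hID).some.injective this)).1
    · have := hw I hI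
      simp only [φ, dif_neg hIc, dif_neg hID] at this
      exact (e1 I hIc).some.injective this

/-- A rate `t` of each message in `D` is exchanged for a rate `k t` of the message `c`. -/
theorem exchange_mem_capacityRegion (D : Finset (Fin 7)) {c : Fin 7} (hc : c ∉ D) (k : ℕ)
    (hcode : ∀ B : ℕ, 1 ≤ B → ∃ κ : Fin 7 → (Fin k → Fin B) → Fin B, ∀ i ∈ recipients c, ∀ s s',
      (∀ J ∈ D, i ∈ recipients J → κ J s = κ J s') → s = s')
    {R : Fin 7 → ℝ} (hR : R ∈ ch.capacityRegion) {t : ℝ} (ht : 0 ≤ t) (hD : ∀ J ∈ D, t < R J) :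
    (fun I => R I + ((if I = c then k * t else 0) - if I ∈ D then t else 0)) ∈
      ch.capacityRegion := by
  -- The strict inequalities pass to nearby achievable vectors, so `R` itself may be taken
  -- achievable.
  have hU : IsOpen {r : Fin 7 → ℝ | ∀ J ∈ D, t < r J} := by
    have : {r : Fin 7 → ℝ | ∀ J ∈ D, t < r J} = ⋂ J ∈ D, {r | t < r J} := by
      ext; simp
    rw [this]
    exact isOpen_biInter_finset fun J _ => isOpen_lt continuous_const (continuous_apply J)
  have hR' : R ∈ closure ({r : Fin 7 → ℝ | ∀ J ∈ D, t < r J} ∩ {r | ch.Achievable r}) :=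
    hU.inter_closure ⟨hD, hR⟩
  have hcont : Continuous fun r : Fin 7 → ℝ =>
      fun I => r I + ((if I = c then k * t else 0) - if I ∈ D then t else 0) := by fun_prop
  have := map_mem_closure hcont hR' (t := ch.capacityRegion) ?_
  · rwa [capacityRegion, closure_closure] at this
  rintro r ⟨hrD : ∀ J ∈ D, t < r J, hr : ch.Achievable r⟩
  beta_reduce
  have hcv : (if c = c then k * t else 0) - (if c ∈ D then t else 0) = k * t := by simp [hc]
  have hDv : ∀ J ∈ D, (if J = c then k * t else 0) - (if J ∈ D then t else 0) = -t := by
    intro J hJ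
    have : J ≠ c := fun h => hc (h ▸ hJ)
    simp [hJ, this]
  have hev : ∀ J, J ∉ D → J ≠ c →
      (if J = c then k * t else 0) - (if J ∈ D then t else 0) = 0 := by
    intro J hJ hJc
    simp [hJ, hJc]
  have hkt : 0 ≤ k * t := by positivity
  refine mem_capacityRegion_of_forall_pos (fun I => ?_) fun δ hδ => ?_
  · by_cases hIc : I = c
    · subst hIc
      rw [hcv]
      exact add_nonneg (hr.1 _) hkt
    · by_cases hID : I ∈ D
      · rw [hDv I hID]
        linarith [hrD I hID]
      · rw [hev I hID hIc, add_zero]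
        exact hr.1 I
  have hr' := hr
  rw [achievable_iff] at hr' ⊢
  refine ⟨fun I => le_max_right _ _, fun ε hε => ?_⟩
  have t3 : ∀ᶠ n : ℕ in atTop, ((k : ℝ) + 1) / δ ≤ n :=
    (tendsto_natCast_atTop_atTop (R := ℝ)).eventually_ge_atTop _
  filter_upwards [hr'.2 ε hε, t3] with n hn hn3
  rw [div_le_iff₀ hδ] at hn3
  have hn0 : (0 : ℝ) ≤ n := n.cast_nonneg
  have n1 := nonempty_fin_bitCount hr.1 n
  have n2 := nonempty_fin_bitCount (R := fun I =>
    max (r I + ((if I = c then k * t else 0) - if I ∈ D then t else 0) - δ) 0)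
    (fun I => le_max_right _ _) n
  obtain ⟨κ, hκ⟩ := hcode (bitCount (n * t)) (one_le_bitCount (by positivity))
  refine hn.recode (Recodes.of_code D hc κ hκ (fun I => ?_) (fun J hJ => ?_) ?_)
  · by_cases hIc : I = c
    · exact Or.inr hIc
    · left
      simp only [Fintype.card_fin]
      refine bitCount_mono (mul_le_mul_of_nonneg_left (max_le ?_ (hr.1 I)) hn0)
      by_cases hID : I ∈ D
      · rw [hDv I hID]
        linarith
      · rw [hev I hID hIc]
        linarith
  · simp only [Fintype.card_fin]
    refine (bitCount_mul_le _ _).trans (bitCount_mono ?_)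
    rw [← mul_add]
    refine mul_le_mul_of_nonneg_left ?_ hn0
    rw [hDv J hJ, ← le_sub_iff_add_le]
    exact max_le (by linarith) (by linarith [hrD J hJ])
  · simp only [Fintype.card_fin, Fintype.card_pi, Finset.prod_const, Finset.card_univ]
    refine bitCount_le_mul_pow (mul_nonneg hn0 (hr.1 c)) (by positivity) k ?_
    simp only [if_true, if_neg hc, sub_zero]
    rw [mul_max_of_nonneg _ _ hn0, mul_zero]
    refine max_le_max_right _ ?_
    linarith

/-- The repetition code: every message in `D` carries the same symbol, and each recipient of `c`
needs only one copy. -/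
theorem exchange_one_mem_capacityRegion (D : Finset (Fin 7)) {c : Fin 7} (hc : c ∉ D)
    (hD : ∀ i ∈ recipients c, ∃ J ∈ D, i ∈ recipients J)
    {R : Fin 7 → ℝ} (hR : R ∈ ch.capacityRegion) {t : ℝ} (ht : 0 ≤ t) (htD : ∀ J ∈ D, t < R J) :
    (fun I => R I + ((if I = c then t else 0) - if I ∈ D then t else 0)) ∈
      ch.capacityRegion := by
  have := exchange_mem_capacityRegion D hc 1 (fun B _ => ⟨fun _ s => s 0, fun i hi s s' h => ?_⟩)
    hR ht htD
  · simpa using this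
  · obtain ⟨J, hJ, hiJ⟩ := hD i hi
    funext j
    rw [Subsingleton.elim j 0]
    exact h J hJ hiJ

/-- Two parts of the common message are sent, with their sum, over the three messages that have two
recipients. -/
theorem exchange_two_mem_capacityRegion
    {R : Fin 7 → ℝ} (hR : R ∈ ch.capacityRegion) {t : ℝ} (ht : 0 ≤ t)
    (htD : ∀ J ∈ ({3, 4, 5} : Finset (Fin 7)), t < R J) :
    (fun I => R I + ((if I = 6 then 2 * t else 0) -
      if I ∈ ({3, 4, 5} : Finset (Fin 7)) then t else 0)) ∈ ch.capacityRegion := by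
  refine exchange_mem_capacityRegion {3, 4, 5} (c := 6) (by decide) 2 (fun B hB => ?_) hR ht htD
  have : NeZero B := ⟨by omega⟩
  -- Each receiver sees two of the three symbols, and any two of them determine both parts.
  refine ⟨fun J s => if J = 3 then s 0 else if J = 4 then s 1 else s 0 + s 1,
    fun i _ s s' h => ?_⟩
  have h3 : i ∈ recipients 3 → s 0 = s' 0 := fun hi => h 3 (by decide) hi
  have h4 : i ∈ recipients 4 → s 1 = s' 1 := fun hi => h 4 (by decide) hi
  have h5 : i ∈ recipients 5 → s 0 + s 1 = s' 0 + s' 1 := fun hi => h 5 (by decide) hi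
  have : s 0 = s' 0 ∧ s 1 = s' 1 := by
    fin_cases i
    · exact ⟨h3 (by decide), h4 (by decide)⟩
    · have a := h3 (by decide)
      have b := h5 (by decide)
      rw [a] at b
      exact ⟨a, add_left_cancel b⟩
    · have a := h4 (by decide)
      have b := h5 (by decide)
      rw [a] at b
      exact ⟨add_right_cancel b, a⟩
  funext j
  fin_cases j
  · exact this.1
  · exact this.2

end BroadcastChannel

/-! ### The cone `Hstar3`, and projection onto a convex set. -/

theorem mem_Hstar3_iff {α : Fin 7 → ℝ} : α ∈ Hstar3 ↔ (∀ I, 0 ≤ α I) ∧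
    (α 3 ≤ α 0 + α 1 ∧ α 4 ≤ α 0 + α 2 ∧ α 5 ≤ α 1 + α 2) ∧
    (α 0 ≤ α 3 ∧ α 1 ≤ α 3 ∧ α 0 ≤ α 4 ∧ α 2 ≤ α 4 ∧ α 1 ≤ α 5 ∧ α 2 ≤ α 5) ∧
    (α 3 ≤ α 6 ∧ α 4 ≤ α 6 ∧ α 5 ≤ α 6) ∧
    (α 6 ≤ α 2 + α 3 ∧ α 6 ≤ α 1 + α 4 ∧ α 6 ≤ α 0 + α 5) ∧
    2 * α 6 ≤ α 3 + α 4 + α 5 := by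
  have h : Matrix.vecMul α HBC3 = ![α 3 - α 0 - α 1, α 4 - α 0 - α 2, α 5 - α 1 - α 2, α 0 - α 3,
      α 1 - α 3, α 6 - α 2 - α 3, α 0 - α 4, α 6 - α 1 - α 4, α 2 - α 4, α 6 - α 0 - α 5,
      α 1 - α 5, α 2 - α 5, α 3 - α 6, α 4 - α 6, α 5 - α 6,
      2 * α 6 - α 3 - α 4 - α 5] := by
    ext j
    fin_cases j <;>
      simp [HBC3, Matrix.vecMul, dotProduct, Fin.sum_univ_seven, Matrix.of_apply] <;> ring
  have h' : α ∈ Hstar3 ↔ (∀ I, 0 ≤ α I) ∧ ∀ j, Matrix.vecMul α HBC3 j ≤ 0 := Iff.rfl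
  rw [h', h]
  refine and_congr_right fun _ => ?_
  simp only [Fin.forall_fin_succ, IsEmpty.forall_iff, and_true, Matrix.cons_val_zero,
    Matrix.cons_val_succ]
  constructor
  · rintro ⟨h1, h2, h3, h4, h5, h6, h7, h8, h9, h10, h11, h12, h13, h14, h15, h16⟩
    and_intros <;> linarith
  · rintro ⟨⟨h1, h2, h3⟩, ⟨h4, h5, h6, h7, h8, h9⟩, ⟨h10, h11, h12⟩, ⟨h13, h14, h15⟩, h16⟩
    and_intros <;> linarith

/-- Weights on the messages whose recipients lie in `A` extend to an element of `H*₃`. -/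
theorem exists_mem_Hstar3_extension (A : Finset (Fin 3)) (α : Fin 7 → ℝ)
    (h0 : ∀ I, recipients I ⊆ A → 0 ≤ α I)
    (h1 : ∀ (D : Finset (Fin 7)) (c : Fin 7), c ∉ D → (∀ J ∈ D, recipients J ⊆ A) →
      (∀ i ∈ recipients c, ∃ J ∈ D, i ∈ recipients J) → α c ≤ ∑ J ∈ D, α J)
    (h2 : A = Finset.univ → 2 * α 6 ≤ α 3 + α 4 + α 5) :
    ∃ β ∈ Hstar3, ∀ I, recipients I ⊆ A → β I = α I := by
  have k1 : ∀ a c : Fin 7, a ≠ c ∧ recipients c ⊆ recipients a ∧ recipients a ⊆ A → α c ≤ α a := by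
    rintro a c ⟨hac, hca, ha⟩
    simpa using h1 {a} c (by simpa using hac.symm) (by simpa using ha)
      (fun i hi => ⟨a, by simp, hca hi⟩)
  have k2 : ∀ a b c : Fin 7, a ≠ b ∧ c ≠ a ∧ c ≠ b ∧
      recipients c = recipients a ∪ recipients b ∧ recipients a ⊆ A ∧ recipients b ⊆ A →
      α c ≤ α a + α b := by
    rintro a b c ⟨hab, hca, hcb, hc, ha, hb⟩
    have := h1 {a, b} c (by simp [hca, hcb]) (by simp [ha, hb]) (fun i hi => by
      rw [hc, Finset.mem_union] at hi
      rcases hi with hi | hi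
      · exact ⟨a, by simp, hi⟩
      · exact ⟨b, by simp, hi⟩)
    rwa [Finset.sum_pair hab] at this
  have hA : A = ∅ ∨ A = {0} ∨ A = {1} ∨ A = {2} ∨ A = {0, 1} ∨ A = {0, 2} ∨ A = {1, 2} ∨
      A = Finset.univ := by
    clear h0 h1 h2 k1 k2; revert A; decide
  -- In every case the extension gives a message with recipient set `I` the weight of the message
  -- with recipient set `I ∩ A`, and weight `0` if that set is empty.
  rcases hA with rfl | rfl | rfl | rfl | rfl | rfl | rfl | rfl
  · exact ⟨0, by simp [mem_Hstar3_iff], fun I hI => by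
      exfalso; clear h0 h1 h2 k1 k2; revert I; decide⟩
  · have := h0 0 (by decide)
    refine ⟨![α 0, 0, 0, α 0, α 0, 0, α 0], ?_, fun I hI => ?_⟩
    · simp [mem_Hstar3_iff, Fin.forall_fin_succ]; and_intros <;> linarith
    · fin_cases I <;> first | rfl | (exfalso; revert hI; decide)
  · have := h0 1 (by decide)
    refine ⟨![0, α 1, 0, α 1, 0, α 1, α 1], ?_, fun I hI => ?_⟩
    · simp [mem_Hstar3_iff, Fin.forall_fin_succ]; and_intros <;> linarith
    · fin_cases I <;> first | rfl | (exfalso; revert hI; decide)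
  · have := h0 2 (by decide)
    refine ⟨![0, 0, α 2, 0, α 2, α 2, α 2], ?_, fun I hI => ?_⟩
    · simp [mem_Hstar3_iff, Fin.forall_fin_succ]; and_intros <;> linarith
    · fin_cases I <;> first | rfl | (exfalso; revert hI; decide)
  · have a0 := h0 0 (by decide)
    have a1 := h0 1 (by decide)
    have a2 := k1 3 0 (by decide)
    have a3 := k1 3 1 (by decide)
    have a4 := k2 0 1 3 (by decide)
    refine ⟨![α 0, α 1, 0, α 3, α 0, α 1, α 3], ?_, fun I hI => ?_⟩
    · simp [mem_Hstar3_iff, Fin.forall_fin_succ]; and_intros <;> linarith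
    · fin_cases I <;> first | rfl | (exfalso; revert hI; decide)
  · have a0 := h0 0 (by decide)
    have a1 := h0 2 (by decide)
    have a2 := k1 4 0 (by decide)
    have a3 := k1 4 2 (by decide)
    have a4 := k2 0 2 4 (by decide)
    refine ⟨![α 0, 0, α 2, α 0, α 4, α 2, α 4], ?_, fun I hI => ?_⟩
    · simp [mem_Hstar3_iff, Fin.forall_fin_succ]; and_intros <;> linarith
    · fin_cases I <;> first | rfl | (exfalso; revert hI; decide)
  · have a0 := h0 1 (by decide)
    have a1 := h0 2 (by decide)
    have a2 := k1 5 1 (by decide)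
    have a3 := k1 5 2 (by decide)
    have a4 := k2 1 2 5 (by decide)
    refine ⟨![0, α 1, α 2, α 1, α 2, α 5, α 5], ?_, fun I hI => ?_⟩
    · simp [mem_Hstar3_iff, Fin.forall_fin_succ]; and_intros <;> linarith
    · fin_cases I <;> first | rfl | (exfalso; revert hI; decide)
  · refine ⟨α, mem_Hstar3_iff.2 ⟨fun I => h0 I (Finset.subset_univ _),
      ⟨k2 0 1 3 (by decide), k2 0 2 4 (by decide), k2 1 2 5 (by decide)⟩,
      ⟨k1 _ _ (by decide), k1 _ _ (by decide), k1 _ _ (by decide), k1 _ _ (by decide),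
        k1 _ _ (by decide), k1 _ _ (by decide)⟩,
      ⟨k1 _ _ (by decide), k1 _ _ (by decide), k1 _ _ (by decide)⟩,
      ⟨k2 _ _ _ (by decide), k2 _ _ _ (by decide), k2 _ _ _ (by decide)⟩, h2 rfl⟩,
      fun I _ => rfl⟩

/-- The nearest point of a compact convex set. -/
theorem exists_nearest_point {C : Set (Fin 7 → ℝ)} (hC : IsCompact C) (hconv : Convex ℝ C)
    (hne : C.Nonempty) {x : Fin 7 → ℝ} (hx : x ∉ C) :
    ∃ p ∈ C, (∀ r ∈ C, (x - p) ⬝ᵥ r ≤ (x - p) ⬝ᵥ p) ∧ (x - p) ⬝ᵥ p < (x - p) ⬝ᵥ x ∧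
      ∀ r ∈ C, (x - p) ⬝ᵥ (x - p) ≤ (x - r) ⬝ᵥ (x - r) := by
  have hcont : Continuous fun r : Fin 7 → ℝ => (x - r) ⬝ᵥ (x - r) := by
    unfold dotProduct; fun_prop
  obtain ⟨p, hp, hmin⟩ := hC.exists_isMinOn hne hcont.continuousOn
  refine ⟨p, hp, fun r hr => ?_, ?_, fun r hr => hmin hr⟩
  · by_contra! hlt
    set a := (x - p) ⬝ᵥ (r - p) with ha
    have ha0 : 0 < a := by rw [ha, dotProduct_sub]; linarith
    set b := (r - p) ⬝ᵥ (r - p) with hb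
    have hb0 : 0 ≤ b := Finset.sum_nonneg fun I _ => mul_self_nonneg _
    have key : ∀ t : ℝ, 0 ≤ t → t ≤ 1 → 2 * t * a ≤ t ^ 2 * b := by
      intro t ht0 ht1
      have hmem : p + t • (r - p) ∈ C := by
        have := hconv hp hr (sub_nonneg.2 ht1) ht0 (by ring)
        convert this using 1
        module
      have := hmin hmem
      have e : (x - (p + t • (r - p))) ⬝ᵥ (x - (p + t • (r - p))) =
          (x - p) ⬝ᵥ (x - p) - 2 * t * a + t ^ 2 * b := by
        have : x - (p + t • (r - p)) = (x - p) - t • (r - p) := by module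
        rw [this]
        simp only [sub_dotProduct (x - p), dotProduct_sub _ (x - p) (t • (r - p)), smul_dotProduct,
          dotProduct_smul, smul_eq_mul]
        rw [dotProduct_comm (r - p) (x - p)]
        ring
      simp only [Set.mem_ofPred_eq] at this
      rw [e] at this
      linarith
    -- This `t` lies in `[0, 1]` even when `b` is small, and it turns the inequality into `2 (a + b)
    -- ≤ b`.
    have hm := key (a / (a + b)) (by positivity) (by rw [div_le_one (by linarith)]; linarith)
    have hab : 0 < a + b := by linarith
    rw [div_pow] at hm
    have : 2 * a * a * (a + b) ≤ a ^ 2 * b := by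
      have h3 := mul_le_mul_of_nonneg_right hm (sq_nonneg (a + b))
      have e1 : 2 * (a / (a + b)) * a * (a + b) ^ 2 = 2 * a * a * (a + b) := by field_simp
      have e2 : a ^ 2 / (a + b) ^ 2 * b * (a + b) ^ 2 = a ^ 2 * b := by field_simp
      linarith
    nlinarith [mul_pos ha0 ha0, mul_pos (mul_pos ha0 ha0) ha0, mul_nonneg (sq_nonneg a) hb0]
  · rw [← sub_pos, ← dotProduct_sub]
    have hne : x - p ≠ 0 := fun h => hx (by rwa [sub_eq_zero.1 h])
    have h0 : 0 ≤ (x - p) ⬝ᵥ (x - p) := Finset.sum_nonneg fun I _ => mul_self_nonneg _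
    exact lt_of_le_of_ne h0 fun h => hne (dotProduct_self_eq_zero.1 h.symm)

/-! ### Normals of the capacity region, and separation by elements of `Hstar3`. -/

namespace BroadcastChannel

variable {ch : BroadcastChannel}

theorem exists_pos_lt_of_forall_pos {ι : Type*} (D : Finset ι) {p : ι → ℝ} (h : ∀ J ∈ D, 0 < p J) :
    ∃ t > 0, ∀ J ∈ D, t < p J := by
  have : ∀ᶠ t : ℝ in 𝓝[>] 0, ∀ J ∈ D, t < p J :=
    (eventually_all_finset D).2 fun J hJ => nhdsWithin_le_nhds (gt_mem_nhds (h J hJ))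
  obtain ⟨t, h1, h2⟩ := (this.and self_mem_nhdsWithin).exists
  exact ⟨t, h2, h1⟩

/-- A vector that is normal to the capacity region at a point whose positive rates are those of the
messages with recipients in `A`. -/
theorem exists_mem_Hstar3_of_normal (A : Finset (Fin 3)) {p α : Fin 7 → ℝ}
    (hp : p ∈ ch.capacityRegion) (hα : ∀ r ∈ ch.capacityRegion, α ⬝ᵥ r ≤ α ⬝ᵥ p)
    (hA : ∀ J, recipients J ⊆ A → 0 < p J) :
    ∃ β ∈ Hstar3, ∀ I, recipients I ⊆ A → β I = α I := by
  -- A normal is nonpositive on feasible directions. Dropping one rate to `0` gives nonnegativity of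
  -- `α`; the two kinds of exchange give the other inequalities.
  have hdot : ∀ v : Fin 7 → ℝ, (fun I => p I + v I) ∈ ch.capacityRegion → α ⬝ᵥ v ≤ 0 := by
    intro v hv
    have h1 := hα _ hv
    have h2 : (fun I => p I + v I) = p + v := rfl
    rw [h2, dotProduct_add] at h1
    linarith
  have hsum : ∀ (D : Finset (Fin 7)) (c : Fin 7) (s t : ℝ),
      α ⬝ᵥ (fun I => (if I = c then s else 0) - if I ∈ D then t else 0) =
        s * α c - t * ∑ J ∈ D, α J := by
    intro D c s t
    simp only [dotProduct, mul_sub, mul_ite, mul_zero, Finset.sum_sub_distrib,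
      Finset.sum_ite_eq', Finset.mem_univ, if_true, Finset.sum_ite_mem, Finset.univ_inter,
      Finset.mul_sum]
    congr 1
    · ring
    · exact Finset.sum_congr rfl fun J _ => mul_comm _ _
  refine exists_mem_Hstar3_extension A α (fun I hI => ?_) (fun D c hc hDA hD => ?_) fun hAu => ?_
  · have h1 := hdot (fun J => (if J = I then -p I else 0) - if J ∈ (∅ : Finset (Fin 7)) then 0 else 0)
      (capacityRegion_anti hp (fun J => ?_) fun J => ?_)
    · rw [hsum] at h1
      have := hA I hI
      by_contra! hneg
      simp only [zero_mul, sub_zero] at h1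
      nlinarith
    · by_cases hJ : J = I
      · subst hJ; simp
      · simp [hJ, nonneg_of_mem_capacityRegion hp J]
    · by_cases hJ : J = I
      · subst hJ; simp [nonneg_of_mem_capacityRegion hp]
      · simp [hJ]
  · obtain ⟨t, ht, htD⟩ := exists_pos_lt_of_forall_pos D fun J hJ => hA J (hDA J hJ)
    have h1 := hdot _ (exchange_one_mem_capacityRegion D hc hD hp ht.le htD)
    rw [hsum, ← mul_sub] at h1
    have := nonpos_of_mul_nonpos_right h1 ht
    linarith
  · obtain ⟨t, ht, htD⟩ := exists_pos_lt_of_forall_pos ({3, 4, 5} : Finset (Fin 7))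
      fun J _ => hA J (by rw [hAu]; exact Finset.subset_univ _)
    have h1 := hdot _ (exchange_two_mem_capacityRegion hp ht.le htD)
    rw [hsum, mul_comm 2 t, mul_assoc, ← mul_sub] at h1
    have := nonpos_of_mul_nonpos_right h1 ht
    have h3 : ∑ J ∈ ({3, 4, 5} : Finset (Fin 7)), α J = α 3 + (α 4 + α 5) := by
      rw [Finset.sum_insert (by decide), Finset.sum_pair (by decide)]
    linarith

theorem mem_Hstar3_of_mem_sumRateMaximizers {R α : Fin 7 → ℝ} (hR : ∀ I, 0 < R I)
    (h : R ∈ ch.sumRateMaximizers α) : α ∈ Hstar3 := by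
  obtain ⟨β, hβ, he⟩ := exists_mem_Hstar3_of_normal Finset.univ h.1 h.2 fun J _ => hR J
  have : β = α := funext fun I => he I (Finset.subset_univ _)
  exact this ▸ hβ

/-- The capacity region has a point in which all rates are positive that are positive somewhere in
the region; these are the rates of the messages whose recipients lie in some set `A`. -/
theorem exists_maximal_support (ch : BroadcastChannel) :
    ∃ q ∈ ch.capacityRegion, ∃ A : Finset (Fin 3), (∀ J, recipients J ⊆ A → 0 < q J) ∧
      ∀ r ∈ ch.capacityRegion, ∀ J, 0 < r J → recipients J ⊆ A := by
  have hex : ∀ I, ∃ r ∈ ch.capacityRegion, ∀ r' ∈ ch.capacityRegion, 0 < r' I → 0 < r I := by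
    intro I
    by_cases h : ∃ r ∈ ch.capacityRegion, 0 < r I
    · obtain ⟨r, hr, hpos⟩ := h
      exact ⟨r, hr, fun _ _ _ => hpos⟩
    · push Not at h
      exact ⟨0, zero_mem_capacityRegion, fun r' hr' hpos => absurd hpos (h r' hr').not_gt⟩
  choose r hr hmax using hex
  set q : Fin 7 → ℝ := ∑ I, (1 / 7 : ℝ) • r I with hqdef
  have hq : q ∈ ch.capacityRegion :=
    ch.convex_capacityRegion.sum_mem (fun _ _ => by norm_num) (by simp) fun I _ => hr I
  have hqpos : ∀ r' ∈ ch.capacityRegion, ∀ J, 0 < r' J → 0 < q J := by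
    intro r' hr' J hJ
    have h1 : q J = ∑ I, (1 / 7 : ℝ) * r I J := by
      simp [hqdef, Finset.sum_apply]
    rw [h1]
    refine Finset.sum_pos' (fun I _ => mul_nonneg (by norm_num)
      (nonneg_of_mem_capacityRegion (hr I) J)) ⟨J, Finset.mem_univ _, ?_⟩
    have := hmax J r' hr' hJ
    positivity
  have hex1 : ∀ (D : Finset (Fin 7)) (c : Fin 7), c ∉ D →
      (∀ i ∈ recipients c, ∃ J ∈ D, i ∈ recipients J) → (∀ J ∈ D, 0 < q J) → 0 < q c := by
    intro D c hc hD hpos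
    obtain ⟨t, ht, htD⟩ := exists_pos_lt_of_forall_pos D hpos
    refine hqpos _ (exchange_one_mem_capacityRegion D hc hD hq ht.le htD) c ?_
    have := nonneg_of_mem_capacityRegion hq c
    simp only [if_true, if_neg hc, sub_zero]
    linarith
  -- `A` consists of the receivers with positive private rate at `q`. Private rates inside `A` can
  -- be traded for any message inside `A`, and a message can be traded for a private message of any
  -- of its recipients.
  let e : Fin 3 → Fin 7 := ![0, 1, 2]
  have he : ∀ i, recipients (e i) = {i} := by decide
  have hA : ∀ J, recipients J ⊆ Finset.univ.filter (fun i => 0 < q (e i)) → 0 < q J := by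
    intro J hJ
    by_cases hJe : ∃ i, J = e i
    · obtain ⟨i, rfl⟩ := hJe
      have := hJ (show i ∈ recipients (e i) by rw [he]; simp)
      simpa using this
    · push Not at hJe
      refine hex1 ((recipients J).image e) J ?_ (fun i hi => ⟨e i, Finset.mem_image_of_mem _ hi,
        by rw [he]; simp⟩) fun K hK => ?_
      · rw [Finset.mem_image]
        rintro ⟨i, -, hi⟩
        exact hJe i hi.symm
      · obtain ⟨i, hi, rfl⟩ := Finset.mem_image.1 hK
        simpa using hJ hi
  refine ⟨q, hq, _, hA, fun r' hr' J hJ i hi => ?_⟩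
  have hqJ := hqpos r' hr' J hJ
  rw [Finset.mem_filter]
  refine ⟨Finset.mem_univ _, ?_⟩
  by_cases hJe : J = e i
  · exact hJe ▸ hqJ
  · refine hex1 {J} (e i) (by simpa using Ne.symm hJe) (fun j hj => ⟨J, by simp, ?_⟩) (by simpa)
    rw [he, Finset.mem_singleton] at hj
    exact hj ▸ hi

/-- A rate vector outside the capacity region is separated from it by a weight vector in `H*₃`. -/
theorem exists_separating_mem_Hstar3 {R : Fin 7 → ℝ} (hR0 : ∀ I, 0 ≤ R I)
    (hR : R ∉ ch.capacityRegion) :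
    ∃ β ∈ Hstar3, ∀ r ∈ ch.capacityRegion, β ⬝ᵥ r < β ⬝ᵥ R := by
  obtain ⟨q, hq, A, hAq, hA⟩ := ch.exists_maximal_support
  have hzero : ∀ r ∈ ch.capacityRegion, ∀ J, ¬ recipients J ⊆ A → r J = 0 := fun r hr J hJ =>
    le_antisymm (not_lt.1 fun h => hJ (hA r hr J h)) (nonneg_of_mem_capacityRegion hr J)
  by_cases hsup : ∃ I, 0 < R I ∧ ¬ recipients I ⊆ A
  · obtain ⟨I, hI, hIA⟩ := hsup
    obtain ⟨i, hi, hiA⟩ := Finset.not_subset.1 hIA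
    -- Receiver `i` gets nothing anywhere in the region, so the total rate meant for it vanishes
    -- there but not at `R`.
    refine ⟨fun J => if i ∈ recipients J then 1 else 0, ?_, fun r hr => ?_⟩
    · rw [mem_Hstar3_iff]
      refine ⟨fun J => by positivity, ?_⟩
      clear hi hiA
      fin_cases i <;> simp [recipients] <;> norm_num
    · have h1 : (fun J => if i ∈ recipients J then (1 : ℝ) else 0) ⬝ᵥ r = 0 := by
        refine Finset.sum_eq_zero fun J _ => ?_
        by_cases hJ : i ∈ recipients J
        · rw [hzero r hr J fun h => hiA (h hJ), mul_zero]
        · simp [hJ]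
      rw [h1]
      refine Finset.sum_pos' (fun J _ => mul_nonneg (by positivity) (hR0 J))
        ⟨I, Finset.mem_univ _, by simpa [hi] using hI⟩
  push Not at hsup
  have hRz : ∀ J, ¬ recipients J ⊆ A → R J = 0 := fun J hJ =>
    le_antisymm (not_lt.1 fun h => hJ (hsup J h)) (hR0 J)
  have hC := ch.isCompact_capacityRegion
  -- Projecting `R` itself could give a point with vanishing rates inside `A`. Instead a point of
  -- the segment from `q` to `R` is projected, taken just after the segment leaves the region.
  let f : ℝ → Fin 7 → ℝ := fun s => (1 - s) • q + s • R
  have hf : Continuous f := by fun_prop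
  obtain ⟨s₀, ⟨⟨hs0, hs1⟩, hs0C⟩, hsmax⟩ :
      ∃ s₀ ∈ Set.Icc (0 : ℝ) 1 ∩ f ⁻¹' ch.capacityRegion,
        ∀ s ∈ Set.Icc (0 : ℝ) 1 ∩ f ⁻¹' ch.capacityRegion, s ≤ s₀ := by
    have hcpt : IsCompact (Set.Icc (0 : ℝ) 1 ∩ f ⁻¹' ch.capacityRegion) :=
      isCompact_Icc.inter_right (hC.isClosed.preimage hf)
    exact hcpt.exists_isGreatest ⟨0, by simp, by simpa [f] using hq⟩
  have hs1' : s₀ < 1 := by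
    refine lt_of_le_of_ne hs1 fun h => hR ?_
    have : f s₀ = R := by simp [f, h]
    rw [← this]
    exact hs0C
  -- The nearest point to `f s` is no farther away than `f s₀`, while the entries of `f s` inside
  -- `A` are at least `(1 - s) * q J`. So for `s` near `s₀` the nearest point has positive entries
  -- inside `A`.
  have hev : ∀ᶠ s : ℝ in 𝓝[>] s₀, ∀ J, recipients J ⊆ A →
      (f s - f s₀) ⬝ᵥ (f s - f s₀) < ((1 - s) * q J) ^ 2 := by
    refine eventually_all.2 fun J => ?_
    by_cases hJ : recipients J ⊆ A
    · have hc1 : Continuous fun s => (f s - f s₀) ⬝ᵥ (f s - f s₀) := by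
        unfold dotProduct; fun_prop
      have hc2 : Continuous fun s : ℝ => ((1 - s) * q J) ^ 2 := by fun_prop
      have : (f s₀ - f s₀) ⬝ᵥ (f s₀ - f s₀) < ((1 - s₀) * q J) ^ 2 := by
        rw [sub_self, dotProduct_zero]
        have := hAq J hJ
        have := sub_pos.2 hs1'
        positivity
      filter_upwards [nhdsWithin_le_nhds (hc1.continuousAt.eventually_lt hc2.continuousAt this)]
        with s hs _ using hs
    · exact Eventually.of_forall fun s h => absurd h hJ
  have hev1 : ∀ᶠ s : ℝ in 𝓝[>] s₀, s < 1 := nhdsWithin_le_nhds (gt_mem_nhds hs1')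
  obtain ⟨s, hs, hss1, hss0⟩ := (hev.and (hev1.and self_mem_nhdsWithin)).exists
  have hsC : f s ∉ ch.capacityRegion := fun h =>
    absurd (hsmax s ⟨⟨by linarith, hss1.le⟩, h⟩) hss0.not_ge
  obtain ⟨p, hp, hnormal, hlt, hnear⟩ :=
    exists_nearest_point hC ch.convex_capacityRegion ⟨q, hq⟩ hsC
  have hppos : ∀ J, recipients J ⊆ A → 0 < p J := by
    intro J hJ
    by_contra! hneg
    have h1 := hs J hJ
    have h2 := hnear _ hs0C
    have h3 : (f s - p) J * (f s - p) J ≤ (f s - p) ⬝ᵥ (f s - p) :=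
      Finset.single_le_sum (f := fun J => (f s - p) J * (f s - p) J)
        (fun _ _ => mul_self_nonneg _) (Finset.mem_univ J)
    have h4 : 0 ≤ (1 - s) * q J := mul_nonneg (by linarith) (hAq J hJ).le
    have h5 : (1 - s) * q J ≤ (f s - p) J := by
      simp only [f, Pi.sub_apply, Pi.add_apply, Pi.smul_apply, smul_eq_mul]
      have := mul_nonneg (show 0 ≤ s by linarith) (hR0 J)
      linarith
    have h6 := mul_self_le_mul_self h4 h5
    nlinarith
  obtain ⟨β, hβ, hβα⟩ := exists_mem_Hstar3_of_normal A hp hnormal hppos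
  have hsame : ∀ v : Fin 7 → ℝ, (∀ J, ¬ recipients J ⊆ A → v J = 0) →
      β ⬝ᵥ v = (f s - p) ⬝ᵥ v := by
    intro v hv
    refine Finset.sum_congr rfl fun J _ => ?_
    by_cases hJ : recipients J ⊆ A
    · rw [hβα J hJ]
    · rw [hv J hJ, mul_zero, mul_zero]
  refine ⟨β, hβ, fun r hr => ?_⟩
  rw [hsame r (hzero r hr), hsame R hRz]
  have h1 := hnormal r hr
  have h2 := hnormal q hq
  -- The form exceeds its maximum over the region at `f s` but not at `q`, so it does at the other
  -- end `R`.
  have h3 : (f s - p) ⬝ᵥ f s = (1 - s) * ((f s - p) ⬝ᵥ q) + s * ((f s - p) ⬝ᵥ R) := by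
    conv_lhs => rw [show f s = (1 - s) • q + s • R from rfl]
    rw [dotProduct_add, dotProduct_smul, dotProduct_smul]
    rfl
  have hs0' : 0 < s := by linarith
  by_contra! hcon
  nlinarith

/-- Weighted sum rates attain their maximum. -/
theorem exists_mem_sumRateMaximizers (ch : BroadcastChannel) (α : Fin 7 → ℝ) :
    (ch.sumRateMaximizers α).Nonempty := by
  have hcont : Continuous fun r : Fin 7 → ℝ => α ⬝ᵥ r := by
    unfold dotProduct; fun_prop
  obtain ⟨p, hp, hmax⟩ := ch.isCompact_capacityRegion.exists_isMaxOn
    ⟨0, zero_mem_capacityRegion⟩ hcont.continuousOn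
  exact ⟨p, hp, fun r hr => hmax hr⟩

/-- Since maximisers exist, any point of the region may serve as witness. -/
theorem mem_supportingHalfspace_iff {α R : Fin 7 → ℝ} :
    R ∈ ch.supportingHalfspace α ↔
      (∀ I, 0 ≤ R I) ∧ ∃ r ∈ ch.capacityRegion, α ⬝ᵥ R ≤ α ⬝ᵥ r := by
  constructor
  · rintro ⟨h0, r, hr, h⟩
    exact ⟨h0, r, hr.1, h⟩
  · rintro ⟨h0, r, hr, h⟩
    obtain ⟨p, hp⟩ := ch.exists_mem_sumRateMaximizers α
    exact ⟨h0, p, hp, h.trans (hp.2 r hr)⟩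

theorem capacityRegion_subset_supportingHalfspace (α : Fin 7 → ℝ) :
    ch.capacityRegion ⊆ ch.supportingHalfspace α := fun R hR =>
  mem_supportingHalfspace_iff.2 ⟨nonneg_of_mem_capacityRegion hR, R, hR, le_rfl⟩

/-- Weights that are dense in `H*₃` up to scaling determine the capacity region. -/
theorem capacityRegion_eq_iInter {A : Set (Fin 7 → ℝ)} (hA : Hstar3 ⊆ closure (raysThrough A)) :
    ch.capacityRegion = ⋂ α ∈ A, ch.supportingHalfspace α := by
  refine Set.Subset.antisymm
    (Set.subset_iInter₂ fun α _ => capacityRegion_subset_supportingHalfspace α) fun R hR => ?_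
  rw [Set.mem_iInter₂] at hR
  have hne : A.Nonempty := by
    by_contra h
    rw [Set.not_nonempty_iff_eq_empty] at h
    have h0 : (0 : Fin 7 → ℝ) ∈ Hstar3 := by simp [mem_Hstar3_iff]
    have := hA h0
    simp [raysThrough, h] at this
  obtain ⟨a, ha⟩ := hne
  have hR0 := (hR a ha).1
  by_contra hRC
  obtain ⟨β, hβ, hsep⟩ := exists_separating_mem_Hstar3 hR0 hRC
  -- By compactness of the region, strict separation is stable under small changes of the weight.
  have hopen : IsOpen {x : Fin 7 → ℝ | ∀ r ∈ ch.capacityRegion, x ⬝ᵥ r < x ⬝ᵥ R} := by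
    have hc : Continuous fun z : (Fin 7 → ℝ) × (Fin 7 → ℝ) => z.1 ⬝ᵥ (R - z.2) := by
      unfold dotProduct; fun_prop
    have hset : {x : Fin 7 → ℝ | ∀ r ∈ ch.capacityRegion, x ⬝ᵥ r < x ⬝ᵥ R} =
        {x | ∀ r ∈ ch.capacityRegion, (x, r) ∈ {z : (Fin 7 → ℝ) × (Fin 7 → ℝ) |
          0 < z.1 ⬝ᵥ (R - z.2)}} := by
      ext x
      simp only [Set.mem_ofPred_eq, dotProduct_sub, sub_pos]
    rw [hset, isOpen_iff_mem_nhds]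
    intro x hx
    exact ch.isCompact_capacityRegion.eventually_forall_of_forall_eventually fun r hr =>
      (isOpen_lt continuous_const hc).mem_nhds (hx r hr)
  obtain ⟨x, hx, t, ht, α, hα, rfl⟩ := mem_closure_iff.1 (hA hβ) _ hopen hsep
  obtain ⟨-, r, hr, hle⟩ := mem_supportingHalfspace_iff.1 (hR α hα)
  have := hx r hr
  rw [smul_dotProduct, smul_dotProduct, smul_eq_mul, smul_eq_mul] at this
  exact absurd this (mul_le_mul_of_nonneg_left hle ht).not_gt

theorem subset_raysThrough (A : Set (Fin 7 → ℝ)) : A ⊆ raysThrough A := fun α hα =>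
  ⟨1, zero_le_one, α, hα, (one_smul _ _).symm⟩

theorem closure_raysThrough {A : Set (Fin 7 → ℝ)} (hcl : IsClosed A)
    (hA : ∀ α ∈ A, ∀ t : ℝ, 0 < t → t • α ∈ A) : closure (raysThrough A) = A := by
  have : raysThrough A = A := by
    refine Set.Subset.antisymm ?_ (subset_raysThrough A)
    rintro _ ⟨t, ht, α, hα, rfl⟩
    rcases ht.eq_or_lt with rfl | ht
    · have hc : Tendsto (fun t : ℝ => t • α) (𝓝[>] 0) (𝓝 ((0 : ℝ) • α)) :=
        ((continuous_id.smul continuous_const).tendsto 0).mono_left nhdsWithin_le_nhds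
      exact hcl.mem_of_tendsto hc (eventually_nhdsWithin_of_forall fun t ht => hA α hα t ht)
    · exact hA α hα t ht
  rw [this, hcl.closure_eq]

/-- Boundary points relative to the orthant have a nonzero normal vector in `H*₃`. -/
theorem exists_normal_mem_Hstar3 {R : Fin 7 → ℝ} (hR : R ∈ ch.capacityRegion)
    (hb : R ∈ closure ({R' : Fin 7 → ℝ | ∀ I, 0 ≤ R' I} \ ch.capacityRegion)) :
    ∃ α ∈ Hstar3, α ≠ 0 ∧ R ∈ ch.sumRateMaximizers α := by
  obtain ⟨x, hx, hlim⟩ := mem_closure_iff_seq_limit.1 hb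
  choose β hβ hsep using fun n => exists_separating_mem_Hstar3 (hx n).1 (hx n).2
  have hsum : ∀ n, 0 < ∑ I, β n I := by
    intro n
    refine lt_of_le_of_ne (Finset.sum_nonneg fun I _ => (mem_Hstar3_iff.1 (hβ n)).1 I) fun h => ?_
    have h0 : β n = 0 := by
      funext I
      exact (Finset.sum_eq_zero_iff_of_nonneg
        fun I _ => (mem_Hstar3_iff.1 (hβ n)).1 I).1 h.symm I (Finset.mem_univ _)
    have := hsep n R hR
    simp [h0] at this
  -- Normalised separators lie in a compact simplex that does not contain `0`, so a limit is again
  -- nonzero.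
  let γ : ℕ → Fin 7 → ℝ := fun n => (∑ I, β n I)⁻¹ • β n
  have hγ : ∀ n, γ n ∈ stdSimplex ℝ (Fin 7) := by
    intro n
    refine ⟨fun I => mul_nonneg (inv_nonneg.2 (hsum n).le) ((mem_Hstar3_iff.1 (hβ n)).1 I), ?_⟩
    simp only [γ, Pi.smul_apply, smul_eq_mul, ← Finset.mul_sum]
    exact inv_mul_cancel₀ (hsum n).ne'
  have hclosed : IsClosed Hstar3 := by
    have h1 : Hstar3 = (⋂ I, {α : Fin 7 → ℝ | 0 ≤ α I}) ∩
        ⋂ j, {α | Matrix.vecMul α HBC3 j ≤ 0} := by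
      ext α
      simp [Hstar3]
    rw [h1]
    refine (isClosed_iInter fun I => isClosed_le continuous_const (continuous_apply I)).inter
      (isClosed_iInter fun j => isClosed_le ?_ continuous_const)
    unfold Matrix.vecMul dotProduct
    fun_prop
  have hγH : ∀ n, γ n ∈ Hstar3 := by
    intro n
    refine ⟨fun I => (hγ n).1 I, fun j => ?_⟩
    simp only [γ, Matrix.smul_vecMul, Pi.smul_apply, smul_eq_mul]
    exact mul_nonpos_of_nonneg_of_nonpos (inv_nonneg.2 (hsum n).le) ((hβ n).2 j)
  obtain ⟨α, hα, φ, hφ, hconv⟩ := (isCompact_stdSimplex ℝ (Fin 7)).tendsto_subseq hγ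
  refine ⟨α, hclosed.mem_of_tendsto hconv (Eventually.of_forall fun n => hγH _), ?_, hR,
    fun r hr => ?_⟩
  · rintro rfl
    have := hα.2
    simp at this
  · have hc : Continuous fun z : (Fin 7 → ℝ) × (Fin 7 → ℝ) => z.1 ⬝ᵥ z.2 := by
      unfold dotProduct; fun_prop
    have l1 := (hc.tendsto (α, R)).comp
      (hconv.prodMk_nhds (hlim.comp hφ.tendsto_atTop))
    have l2 := (hc.tendsto (α, r)).comp (hconv.prodMk_nhds (tendsto_const_nhds (x := r)))
    refine le_of_tendsto_of_tendsto' l2 l1 fun n => ?_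
    simp only [Function.comp_apply, γ, smul_dotProduct, smul_eq_mul]
    exact mul_le_mul_of_nonneg_left (hsep _ r hr).le (inv_nonneg.2 (hsum _).le)

end BroadcastChannel

/-! ### Nonnegativity of linear forms on `H*₃` -/

/-- A linear form on `ℝ⁷`, with coefficients `x, y, z` for the messages with one, two and three
recipients, is nonnegative on the extreme rays of `H*₃`; `yₖ` is the coefficient of the message
for the two receivers other than `k`. -/
structure NonnegOnRays (x₁ x₂ x₃ y₁ y₂ y₃ z : ℝ) : Prop where
  s₁ : 0 ≤ x₁ + y₂ + y₃ + z
  s₂ : 0 ≤ x₂ + y₁ + y₃ + z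
  s₃ : 0 ≤ x₃ + y₁ + y₂ + z
  c₁ : 0 ≤ x₂ + x₃ + y₁ + y₂ + y₃ + z
  c₂ : 0 ≤ x₁ + x₃ + y₁ + y₂ + y₃ + z
  c₃ : 0 ≤ x₁ + x₂ + y₁ + y₂ + y₃ + z
  n : 0 ≤ x₁ + x₂ + x₃ + y₁ + y₂ + y₃ + z
  t : 0 ≤ x₁ + x₂ + x₃ + 2 * y₁ + 2 * y₂ + 2 * y₃ + 2 * z
  u₁ : 0 ≤ x₁ + x₂ + x₃ + 2 * y₁ + y₂ + y₃ + 2 * z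
  u₂ : 0 ≤ x₁ + x₂ + x₃ + y₁ + 2 * y₂ + y₃ + 2 * z
  u₃ : 0 ≤ x₁ + x₂ + x₃ + y₁ + y₂ + 2 * y₃ + 2 * z
  v₁ : 0 ≤ x₁ + 2 * x₂ + 2 * x₃ + 2 * y₁ + 2 * y₂ + 2 * y₃ + 3 * z
  v₂ : 0 ≤ 2 * x₁ + x₂ + 2 * x₃ + 2 * y₁ + 2 * y₂ + 2 * y₃ + 3 * z
  v₃ : 0 ≤ 2 * x₁ + 2 * x₂ + x₃ + 2 * y₁ + 2 * y₂ + 2 * y₃ + 3 * z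
  w : 0 ≤ 2 * x₁ + 2 * x₂ + 2 * x₃ + 2 * y₁ + 2 * y₂ + 2 * y₃ + 3 * z

/-- The inequalities that define `H*₃`, for weights `a, b, c` of the messages with one, two and
three recipients. -/
structure FractionallySubadditive (a₁ a₂ a₃ b₁ b₂ b₃ c : ℝ) : Prop where
  a₁₂ : a₁ ≤ b₂
  a₁₃ : a₁ ≤ b₃
  a₂₁ : a₂ ≤ b₁
  a₂₃ : a₂ ≤ b₃
  a₃₁ : a₃ ≤ b₁
  a₃₂ : a₃ ≤ b₂
  b₁c : b₁ ≤ c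
  b₂c : b₂ ≤ c
  b₃c : b₃ ≤ c
  b₁a : b₁ ≤ a₂ + a₃
  b₂a : b₂ ≤ a₁ + a₃
  b₃a : b₃ ≤ a₁ + a₂
  c₁ : c ≤ a₁ + b₁
  c₂ : c ≤ a₂ + b₂
  c₃ : c ≤ a₃ + b₃
  cb : 2 * c ≤ b₁ + b₂ + b₃

section

variable {a₁ a₂ a₃ b₁ b₂ b₃ c x₁ x₂ x₃ y₁ y₂ y₃ z : ℝ}

/-- Pairs are indexed by the missing receiver, so a cyclic relabelling of the receivers shifts all
indices alike. -/
theorem NonnegOnRays.cycle (h : NonnegOnRays x₁ x₂ x₃ y₁ y₂ y₃ z) :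
    NonnegOnRays x₂ x₃ x₁ y₂ y₃ y₁ z := by
  obtain ⟨h1, h2, h3, h4, h5, h6, h7, h8, h9, h10, h11, h12, h13, h14, h15⟩ := h
  constructor <;> linarith

theorem FractionallySubadditive.cycle (h : FractionallySubadditive a₁ a₂ a₃ b₁ b₂ b₃ c) :
    FractionallySubadditive a₂ a₃ a₁ b₂ b₃ b₁ c := by
  obtain ⟨h1, h2, h3, h4, h5, h6, h7, h8, h9, h10, h11, h12, h13, h14, h15, h16⟩ := h
  constructor <;> linarith

theorem NonnegOnRays.nonneg_of_eq_pair (hx : NonnegOnRays x₁ x₂ x₃ y₁ y₂ y₃ z)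
    (h : FractionallySubadditive a₁ a₂ a₃ b₁ b₂ b₃ c) (he : c = b₃) :
    0 ≤ a₁ * x₁ + a₂ * x₂ + a₃ * x₃ + b₁ * y₁ + b₂ * y₂ + b₃ * y₃ + c * z := by
  subst he
  -- A family of decompositions into rays, with multiplicities `q` of `t` and `u` of `u₃`. With `q =
  -- u = 0` the coefficient of `c₃` or of `n` may be negative; `u` repairs the first and `q` the
  -- second.
  have key : ∀ q u : ℝ, 0 ≤ q → 0 ≤ u → u ≤ c - b₁ → u ≤ c - b₂ → q ≤ b₁ - a₂ → q ≤ b₂ - a₁ →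
      0 ≤ b₁ + b₂ - a₃ - c + u - q → 0 ≤ a₁ + a₂ + a₃ - b₁ - b₂ - u + q →
      0 ≤ a₁ * x₁ + a₂ * x₂ + a₃ * x₃ + b₁ * y₁ + b₂ * y₂ + c * y₃ + c * z := by
    intro q u hq hu h1 h2 h3 h4 h5 h6
    linarith [mul_nonneg hq hx.t, mul_nonneg hu hx.u₃, mul_nonneg (sub_nonneg.2 h1) hx.s₁,
      mul_nonneg (sub_nonneg.2 h2) hx.s₂, mul_nonneg (sub_nonneg.2 h3) hx.c₂,
      mul_nonneg (sub_nonneg.2 h4) hx.c₁, mul_nonneg h5 hx.c₃, mul_nonneg h6 hx.n]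
  obtain ⟨h1, h2, h3, h4, h5, h6, h7, h8, h9, h10, h11, h12, h13, h14, h15, h16⟩ := h
  by_cases hD : b₁ + b₂ - a₃ - c < 0
  · apply key 0 (-(b₁ + b₂ - a₃ - c)) <;> linarith
  by_cases hE : a₁ + a₂ + a₃ - b₁ - b₂ < 0
  · apply key (-(a₁ + a₂ + a₃ - b₁ - b₂)) 0 <;> linarith
  · apply key 0 0 <;> linarith

/-- On this face the weights are an explicit conic combination of six rays; the sign of `b₁ + b₂ - c
- a₃` decides between `u₃` and `t`. -/
theorem NonnegOnRays.nonneg_of_pair_eq_add (hx : NonnegOnRays x₁ x₂ x₃ y₁ y₂ y₃ z)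
    (h : FractionallySubadditive a₁ a₂ a₃ b₁ b₂ b₃ c) (he : b₃ = a₁ + a₂) :
    0 ≤ a₁ * x₁ + a₂ * x₂ + a₃ * x₃ + b₁ * y₁ + b₂ * y₂ + b₃ * y₃ + c * z := by
  subst he
  rcases le_total (b₁ + b₂) (c + a₃) with hu | hu
  · linarith [mul_nonneg (sub_nonneg.2 h.a₃₁) hx.s₂, mul_nonneg (sub_nonneg.2 h.a₃₂) hx.s₁,
      mul_nonneg (sub_nonneg.2 hu) hx.u₃, mul_nonneg (sub_nonneg.2 h.c₁) hx.c₂,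
      mul_nonneg (sub_nonneg.2 h.c₂) hx.c₁, mul_nonneg (sub_nonneg.2 h.b₃c) hx.s₃]
  · linarith [mul_nonneg (sub_nonneg.2 h.b₁c) hx.s₁, mul_nonneg (sub_nonneg.2 h.b₂c) hx.s₂,
      mul_nonneg (sub_nonneg.2 hu) hx.t, mul_nonneg (sub_nonneg.2 h.b₂a) hx.c₂,
      mul_nonneg (sub_nonneg.2 h.b₁a) hx.c₁, mul_nonneg (sub_nonneg.2 h.b₃c) hx.s₃]

/-- Again six rays suffice; the sign of `a₁ + a₂ + a₃ - b₁ - b₂` decides between `s₃` and `v₃`. -/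
theorem NonnegOnRays.nonneg_of_eq_add (hx : NonnegOnRays x₁ x₂ x₃ y₁ y₂ y₃ z)
    (h : FractionallySubadditive a₁ a₂ a₃ b₁ b₂ b₃ c) (he : c = a₃ + b₃) :
    0 ≤ a₁ * x₁ + a₂ * x₂ + a₃ * x₃ + b₁ * y₁ + b₂ * y₂ + b₃ * y₃ + c * z := by
  subst he
  rcases le_total (a₁ + a₂ + a₃) (b₁ + b₂) with hu | hu
  · linarith [mul_nonneg (sub_nonneg.2 h.a₂₃) hx.s₁, mul_nonneg (sub_nonneg.2 h.a₁₃) hx.s₂,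
      mul_nonneg (sub_nonneg.2 hu) hx.s₃, mul_nonneg (sub_nonneg.2 h.b₂a) hx.u₁,
      mul_nonneg (sub_nonneg.2 h.b₁a) hx.u₂, mul_nonneg (sub_nonneg.2 h.cb) hx.c₃]
  · linarith [mul_nonneg (sub_nonneg.2 h.a₂₃) hx.s₁, mul_nonneg (sub_nonneg.2 h.a₁₃) hx.s₂,
      mul_nonneg (sub_nonneg.2 hu) hx.v₃, mul_nonneg (sub_nonneg.2 h.a₂₁) hx.u₁,
      mul_nonneg (sub_nonneg.2 h.a₁₂) hx.u₂, mul_nonneg (sub_nonneg.2 h.cb) hx.c₃]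

/-- The fifteen rays generate the cone. The ray `w = (2, 2, 2, 2, 2, 2, 3)` is tight in `a ≤ b` and
in `2 c ≤ b₁ + b₂ + b₃`, so subtracting `t` times it lowers only the nine other slacks, scaled here
to fall at equal speed. Taking `t` to be the least of these leads to a face, which up to cyclic
symmetry is one of the three treated above. -/
theorem NonnegOnRays.nonneg (hx : NonnegOnRays x₁ x₂ x₃ y₁ y₂ y₃ z)
    (h : FractionallySubadditive a₁ a₂ a₃ b₁ b₂ b₃ c) :
    0 ≤ a₁ * x₁ + a₂ * x₂ + a₃ * x₃ + b₁ * y₁ + b₂ * y₂ + b₃ * y₃ + c * z := by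
  obtain ⟨i, hi⟩ := Finite.exists_min (![c - b₁, c - b₂, c - b₃, (a₂ + a₃ - b₁) / 2,
    (a₁ + a₃ - b₂) / 2, (a₁ + a₂ - b₃) / 2, a₁ + b₁ - c, a₂ + b₂ - c, a₃ + b₃ - c] : Fin 9 → ℝ)
  generalize ht : (![c - b₁, c - b₂, c - b₃, (a₂ + a₃ - b₁) / 2,
    (a₁ + a₃ - b₂) / 2, (a₁ + a₂ - b₃) / 2, a₁ + b₁ - c, a₂ + b₂ - c, a₃ + b₃ - c] : Fin 9 → ℝ) i
    = t at hi
  have k0 : t ≤ c - b₁ := hi 0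
  have k1 : t ≤ c - b₂ := hi 1
  have k2 : t ≤ c - b₃ := hi 2
  have k3 : t ≤ (a₂ + a₃ - b₁) / 2 := hi 3
  have k4 : t ≤ (a₁ + a₃ - b₂) / 2 := hi 4
  have k5 : t ≤ (a₁ + a₂ - b₃) / 2 := hi 5
  have k6 : t ≤ a₁ + b₁ - c := hi 6
  have k7 : t ≤ a₂ + b₂ - c := hi 7
  have k8 : t ≤ a₃ + b₃ - c := hi 8
  have h' : FractionallySubadditive (a₁ - 2 * t) (a₂ - 2 * t) (a₃ - 2 * t) (b₁ - 2 * t)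
      (b₂ - 2 * t) (b₃ - 2 * t) (c - 3 * t) := by
    obtain ⟨h1, h2, h3, h4, h5, h6, h7, h8, h9, h10, h11, h12, h13, h14, h15, h16⟩ := h
    constructor <;> linarith
  have ht0 : 0 ≤ t := by
    obtain ⟨h1, h2, h3, h4, h5, h6, h7, h8, h9, h10, h11, h12, h13, h14, h15, h16⟩ := h
    rw [← ht]
    fin_cases i <;> simp <;> linarith
  have hw := mul_nonneg ht0 hx.w
  fin_cases i <;> simp at ht
  · linarith [hx.cycle.nonneg_of_eq_pair h'.cycle (by linarith)]
  · linarith [hx.cycle.cycle.nonneg_of_eq_pair h'.cycle.cycle (by linarith)]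
  · linarith [hx.nonneg_of_eq_pair h' (by linarith)]
  · linarith [hx.cycle.nonneg_of_pair_eq_add h'.cycle (by linarith)]
  · linarith [hx.cycle.cycle.nonneg_of_pair_eq_add h'.cycle.cycle (by linarith)]
  · linarith [hx.nonneg_of_pair_eq_add h' (by linarith)]
  · linarith [hx.cycle.nonneg_of_eq_add h'.cycle (by linarith)]
  · linarith [hx.cycle.cycle.nonneg_of_eq_add h'.cycle.cycle (by linarith)]
  · linarith [hx.nonneg_of_eq_add h' (by linarith)]

end

theorem FractionallySubadditive.of_mem_Hstar3 {α : Fin 7 → ℝ} (h : α ∈ Hstar3) :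
    FractionallySubadditive (α 0) (α 1) (α 2) (α 5) (α 4) (α 3) (α 6) := by
  obtain ⟨-, ⟨h1, h2, h3⟩, ⟨h4, h5, h6, h7, h8, h9⟩, ⟨h10, h11, h12⟩, ⟨h13, h14, h15⟩, h16⟩ :=
    mem_Hstar3_iff.1 h
  constructor <;> linarith

/-! ### Entropy of functions of a uniformly distributed variable -/

section Entropy

open Classical in
/-- The number of points with the same value of `f` as `ω`. -/
noncomputable def fiberCard {Ω S : Type} [Fintype Ω] (f : Ω → S) (ω : Ω) : ℝ :=
  ∑ ω', if f ω' = f ω then 1 else 0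

/-- The entropy (in nats) of `f ω` for a uniformly distributed `ω`. -/
noncomputable def unifEntropy {Ω S : Type} [Fintype Ω] (f : Ω → S) : ℝ :=
  Real.log (Fintype.card Ω) - (∑ ω, Real.log (fiberCard f ω)) / Fintype.card Ω

variable {Ω S T U V : Type} [Fintype Ω]

theorem one_le_fiberCard (f : Ω → S) (ω : Ω) : 1 ≤ fiberCard f ω := by
  classical
  have := Finset.single_le_sum (f := fun ω' => if f ω' = f ω then (1 : ℝ) else 0)
    (fun _ _ => by positivity) (Finset.mem_univ ω)
  simpa [fiberCard] using this

theorem fiberCard_pos (f : Ω → S) (ω : Ω) : 0 < fiberCard f ω :=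
  one_pos.trans_le (one_le_fiberCard f ω)

theorem fiberCard_congr {f : Ω → S} {ω ω' : Ω} (h : f ω = f ω') :
    fiberCard f ω = fiberCard f ω' := by
  unfold fiberCard
  rw [h]

theorem fiberCard_le_of_determines {f : Ω → S} {g : Ω → T} (h : ∀ ω ω', f ω = f ω' → g ω = g ω')
    (ω : Ω) : fiberCard f ω ≤ fiberCard g ω := by
  classical
  refine Finset.sum_le_sum fun ω' _ => ?_
  by_cases hf : f ω' = f ω
  · simp [hf, h _ _ hf]
  · rw [if_neg hf]; positivity

/-- Expand the numerator as a count of pairs `(ω₁, ω₂)` with `f ω₁ = f ω` and `g ω₂ = g ω`. For a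
fixed pair the admissible `ω` are either none or one fibre of `(f, g)`, contributing `1 / fiberCard
z ω₁` in total, and they can exist only if `z ω₁ = z ω₂`. -/
theorem sum_fiberCard_div_le (f : Ω → S) (g : Ω → T) (z : Ω → V)
    (hf : ∀ ω ω', f ω = f ω' → z ω = z ω') (hg : ∀ ω ω', g ω = g ω' → z ω = z ω') :
    ∑ ω, fiberCard f ω * fiberCard g ω / (fiberCard (fun ω => (f ω, g ω)) ω * fiberCard z ω) ≤
      Fintype.card Ω := by
  classical
  set fg : Ω → S × T := fun ω => (f ω, g ω) with hfg
  have h1 : ∀ ω, fiberCard f ω * fiberCard g ω / (fiberCard fg ω * fiberCard z ω) =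
      ∑ ω₁, ∑ ω₂, if f ω₁ = f ω ∧ g ω₂ = g ω then 1 / (fiberCard fg ω * fiberCard z ω) else 0 := by
    intro ω
    rw [div_eq_mul_one_div]
    conv_lhs => rw [fiberCard, fiberCard]
    rw [Finset.sum_mul_sum, Finset.sum_mul]
    refine Finset.sum_congr rfl fun ω₁ _ => ?_
    rw [Finset.sum_mul]
    refine Finset.sum_congr rfl fun ω₂ _ => ?_
    by_cases a : f ω₁ = f ω <;> by_cases b : g ω₂ = g ω <;> simp [a, b]
  have h2 : ∀ ω₁ ω₂, (∑ ω, if f ω₁ = f ω ∧ g ω₂ = g ω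
      then 1 / (fiberCard fg ω * fiberCard z ω) else 0) ≤
      if z ω₂ = z ω₁ then 1 / fiberCard z ω₁ else 0 := by
    intro ω₁ ω₂
    by_cases hex : ∃ ω₀, f ω₁ = f ω₀ ∧ g ω₂ = g ω₀
    · obtain ⟨ω₀, e1, e2⟩ := hex
      have hz1 := hf _ _ e1
      have hz2 := hg _ _ e2
      rw [if_pos (hz2.trans hz1.symm)]
      have : ∀ ω, (if f ω₁ = f ω ∧ g ω₂ = g ω then 1 / (fiberCard fg ω * fiberCard z ω) else 0) =
          (if fg ω = fg ω₀ then 1 else 0) * (1 / (fiberCard fg ω₀ * fiberCard z ω₁)) := by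
        intro ω
        by_cases hω : fg ω = fg ω₀
        · have hω' := Prod.ext_iff.1 hω
          rw [if_pos hω, if_pos ⟨e1.trans hω'.1.symm, e2.trans hω'.2.symm⟩, one_mul,
            fiberCard_congr hω, fiberCard_congr ((hf _ _ hω'.1).trans hz1.symm)]
        · rw [if_neg hω, if_neg, zero_mul]
          rintro ⟨a, b⟩
          exact hω (Prod.ext (a.symm.trans e1) (b.symm.trans e2))
      simp only [this, ← Finset.sum_mul]
      have e : (∑ ω, if fg ω = fg ω₀ then (1 : ℝ) else 0) = fiberCard fg ω₀ := by
        unfold fiberCard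
        exact Finset.sum_congr rfl fun _ _ => by congr
      rw [e]
      have := fiberCard_pos fg ω₀
      have := fiberCard_pos z ω₁
      apply le_of_eq
      field_simp
    · push Not at hex
      rw [Finset.sum_eq_zero]
      · have := fiberCard_pos z ω₁
        positivity
      · intro ω _
        rw [if_neg]
        rintro ⟨a, b⟩
        exact hex ω a b
  simp only [h1]
  rw [Finset.sum_comm]
  calc ∑ ω₁, ∑ ω, ∑ ω₂, _ = ∑ ω₁, ∑ ω₂, ∑ ω, _ :=
        Finset.sum_congr rfl fun ω₁ _ => Finset.sum_comm
    _ ≤ ∑ ω₁, ∑ ω₂, if z ω₂ = z ω₁ then 1 / fiberCard z ω₁ else 0 :=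
        Finset.sum_le_sum fun ω₁ _ => Finset.sum_le_sum fun ω₂ _ => h2 ω₁ ω₂
    _ = ∑ ω₁ : Ω, 1 := by
        refine Finset.sum_congr rfl fun ω₁ _ => ?_
        have e : ∀ ω₂, (if z ω₂ = z ω₁ then 1 / fiberCard z ω₁ else 0) =
            (if z ω₂ = z ω₁ then 1 else 0) * (1 / fiberCard z ω₁) := fun ω₂ => by
          by_cases a : z ω₂ = z ω₁ <;> simp [a]
        simp only [e, ← Finset.sum_mul]
        exact mul_one_div_cancel (fiberCard_pos z ω₁).ne'
    _ = Fintype.card Ω := by simp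

/-- Submodularity of entropy. -/
theorem unifEntropy_submodular [Nonempty Ω] (f : Ω → S) (g : Ω → T) (h : Ω → U) (z : Ω → V)
    (hf : ∀ ω ω', f ω = f ω' → z ω = z ω') (hg : ∀ ω ω', g ω = g ω' → z ω = z ω')
    (hh : ∀ ω ω', f ω = f ω' → g ω = g ω' → h ω = h ω') :
    unifEntropy h + unifEntropy z ≤ unifEntropy f + unifEntropy g := by
  have hN : (0 : ℝ) < Fintype.card Ω := Nat.cast_pos.2 Fintype.card_pos
  have key : ∑ ω, Real.log (fiberCard f ω) + ∑ ω, Real.log (fiberCard g ω) ≤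
      ∑ ω, Real.log (fiberCard h ω) + ∑ ω, Real.log (fiberCard z ω) := by
    rw [← Finset.sum_add_distrib, ← Finset.sum_add_distrib, ← sub_nonpos,
      ← Finset.sum_sub_distrib]
    -- `log x ≤ x - 1`, applied to the ratio of fibre sizes; its average is at most `1`.
    calc _ ≤ ∑ ω, (fiberCard f ω * fiberCard g ω /
          (fiberCard (fun ω => (f ω, g ω)) ω * fiberCard z ω) - 1) := by
          refine Finset.sum_le_sum fun ω _ => ?_
          have p1 := fiberCard_pos f ω
          have p2 := fiberCard_pos g ω
          have p3 := fiberCard_pos z ω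
          have p4 := fiberCard_pos (fun ω => (f ω, g ω)) ω
          have l1 : Real.log (fiberCard (fun ω => (f ω, g ω)) ω) ≤ Real.log (fiberCard h ω) :=
            Real.log_le_log p4 (fiberCard_le_of_determines
              (fun ω ω' e => hh _ _ (Prod.ext_iff.1 e).1 (Prod.ext_iff.1 e).2) ω)
          have l2 := Real.log_le_sub_one_of_pos (div_pos (mul_pos p1 p2) (mul_pos p4 p3))
          rw [Real.log_div (mul_pos p1 p2).ne' (mul_pos p4 p3).ne', Real.log_mul p1.ne' p2.ne',
            Real.log_mul p4.ne' p3.ne'] at l2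
          linarith
      _ ≤ 0 := by
          rw [Finset.sum_sub_distrib, sub_nonpos]
          simpa using sum_fiberCard_div_le f g z hf hg
  have := div_le_div_of_nonneg_right key hN.le
  rw [add_div, add_div] at this
  unfold unifEntropy
  linarith

theorem unifEntropy_const [Nonempty Ω] (s : S) : unifEntropy (fun _ : Ω => s) = 0 := by
  have hN : (Fintype.card Ω : ℝ) ≠ 0 := Nat.cast_ne_zero.2 Fintype.card_ne_zero
  have : ∀ ω : Ω, fiberCard (fun _ : Ω => s) ω = Fintype.card Ω := fun ω => by simp [fiberCard]
  simp only [unifEntropy, this, Finset.sum_const, Finset.card_univ, nsmul_eq_mul]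
  field_simp
  ring

theorem unifEntropy_id : unifEntropy (id : Ω → Ω) = Real.log (Fintype.card Ω) := by
  have : ∀ ω : Ω, fiberCard (id : Ω → Ω) ω = 1 := fun ω => by
    unfold fiberCard
    rw [Finset.sum_eq_single ω] <;> simp +contextual
  simp [unifEntropy, this]

/-- Subadditivity of entropy. -/
theorem unifEntropy_le_add [Nonempty Ω] (f : Ω → S) (g : Ω → T) (h : Ω → U)
    (hh : ∀ ω ω', f ω = f ω' → g ω = g ω' → h ω = h ω') :
    unifEntropy h ≤ unifEntropy f + unifEntropy g := by
  have := unifEntropy_submodular f g h (fun _ => ()) (fun _ _ _ => rfl) (fun _ _ _ => rfl) hh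
  rwa [unifEntropy_const, add_zero] at this

/-- Gibbs' inequality against the uniform distribution on `S`: the sum of `1 / fiberCard f ω` counts
the values that `f` takes. -/
theorem unifEntropy_le_log_card [Nonempty Ω] [Fintype S] (f : Ω → S) :
    unifEntropy f ≤ Real.log (Fintype.card S) := by
  classical
  have hN : (0 : ℝ) < Fintype.card Ω := Nat.cast_pos.2 Fintype.card_pos
  have : Nonempty S := ‹Nonempty Ω›.map f
  have hS : (0 : ℝ) < Fintype.card S := Nat.cast_pos.2 Fintype.card_pos
  have h1 : ∑ ω, 1 / fiberCard f ω ≤ Fintype.card S := by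
    calc ∑ ω, 1 / fiberCard f ω = ∑ s : S, ∑ ω, if f ω = s then 1 / fiberCard f ω else 0 := by
          rw [Finset.sum_comm]
          simp
      _ ≤ ∑ s : S, 1 := by
          refine Finset.sum_le_sum fun s _ => ?_
          by_cases hs : ∃ ω₀, f ω₀ = s
          · obtain ⟨ω₀, rfl⟩ := hs
            have e : ∀ ω, (if f ω = f ω₀ then 1 / fiberCard f ω else 0) =
                (if f ω = f ω₀ then 1 else 0) * (1 / fiberCard f ω₀) := fun ω => by
              by_cases a : f ω = f ω₀
              · rw [if_pos a, if_pos a, one_mul, fiberCard_congr a]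
              · simp [a]
            simp only [e, ← Finset.sum_mul]
            exact (mul_one_div_cancel (fiberCard_pos f ω₀).ne').le
          · push Not at hs
            simp [hs]
      _ = _ := by simp
  have h2 : ∑ ω, (Real.log (Fintype.card Ω) - Real.log (fiberCard f ω) -
      Real.log (Fintype.card S)) ≤ 0 := by
    calc _ ≤ ∑ ω, ((Fintype.card Ω : ℝ) / Fintype.card S * (1 / fiberCard f ω) - 1) := by
          refine Finset.sum_le_sum fun ω _ => ?_
          have p := fiberCard_pos f ω
          have := Real.log_le_sub_one_of_pos
            (show 0 < (Fintype.card Ω : ℝ) / Fintype.card S * (1 / fiberCard f ω) by positivity)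
          rw [Real.log_mul (by positivity) (by positivity), Real.log_div hN.ne' hS.ne', one_div,
            Real.log_inv] at this
          rw [one_div]
          linarith
      _ = (Fintype.card Ω : ℝ) / Fintype.card S * ∑ ω, 1 / fiberCard f ω - Fintype.card Ω := by
          rw [Finset.sum_sub_distrib, Finset.mul_sum]
          simp
      _ ≤ (Fintype.card Ω : ℝ) / Fintype.card S * Fintype.card S - Fintype.card Ω := by
          gcongr
      _ = 0 := by field_simp; ring
  rw [Finset.sum_sub_distrib, Finset.sum_sub_distrib] at h2
  simp only [Finset.sum_const, Finset.card_univ, nsmul_eq_mul] at h2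
  have h3 : unifEntropy f - Real.log (Fintype.card S) = (Fintype.card Ω *
      Real.log (Fintype.card Ω) - ∑ ω, Real.log (fiberCard f ω) -
      Fintype.card Ω * Real.log (Fintype.card S)) / Fintype.card Ω := by
    unfold unifEntropy
    field_simp
  have := div_nonpos_of_nonpos_of_nonneg h2 hN.le
  linarith

end Entropy

/-! ### Messages that are sent over noiseless links -/

/-- The contents of the links and the messages in `F`. -/
def linkData {Ω : Type} {S T : Fin 7 → Type} (P : ∀ I, Ω → S I) (W : ∀ I, Ω → T I)
    (F : Finset (Fin 7)) (ω : Ω) : ∀ I : F, S I × T I := fun I => (P I ω, W I ω)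

theorem linkData_eq_iff {Ω : Type} {S T : Fin 7 → Type} {P : ∀ I, Ω → S I} {W : ∀ I, Ω → T I}
    {F : Finset (Fin 7)} {ω ω' : Ω} :
    linkData P W F ω = linkData P W F ω' ↔ ∀ I ∈ F, P I ω = P I ω' ∧ W I ω = W I ω' := by
  simp [linkData, funext_iff, Prod.ext_iff]

/-- The inequalities between the sizes `s` of the links and `t` of the messages that follow from
properties of the joint entropies `g`. -/
theorem nonnegOnRays_of_submodular {g : Finset (Fin 7) → ℝ} {s t : Fin 7 → ℝ} {K : ℝ} (hK : 0 ≤ K)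
    (hsub : ∀ F G : Finset (Fin 7), g (F ∪ G) + g (F ∩ G) ≤ g F + g G)
    (hext : ∀ F E : Finset (Fin 7), (∀ I ∈ E, ∃ i ∈ recipients I, ∀ J, i ∈ recipients J →
      J ∈ F ∪ E) → g (F ∪ E) ≤ g F + ∑ I ∈ E, s I)
    (hlow : ∀ F : Finset (Fin 7), ∑ I ∈ F, t I - K ≤ g F) (h0 : g ∅ = 0) :
    NonnegOnRays (s 0 - t 0 + K) (s 1 - t 1 + K) (s 2 - t 2 + K) (s 5 - t 5 + K) (s 4 - t 4 + K)
      (s 3 - t 3 + K) (s 6 - t 6 + K) := by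
  have sub : ∀ F G U D : Finset (Fin 7), U = F ∪ G ∧ D = F ∩ G → g U + g D ≤ g F + g G := by
    rintro F G U D ⟨rfl, rfl⟩
    exact hsub F G
  have ext : ∀ (F G : Finset (Fin 7)) (l : List (Fin 7)), l.Nodup ∧ G = F ∪ l.toFinset ∧
      (∀ I ∈ l, ∃ i ∈ recipients I, ∀ J, i ∈ recipients J → J ∈ G) →
      g G ≤ g F + (l.map s).sum := by
    rintro F G l ⟨hl, rfl, h⟩
    rw [← List.sum_toFinset s hl]
    exact hext F l.toFinset fun I hI => h I (List.mem_toFinset.1 hI)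
  have low : ∀ (G : Finset (Fin 7)) (l : List (Fin 7)), l.Nodup ∧ G = l.toFinset →
      (l.map t).sum - K ≤ g G := by
    rintro G l ⟨hl, rfl⟩
    rw [← List.sum_toFinset t hl]
    exact hlow _
  -- The sets used are what receivers see, such as `{0, 3, 4, 6}` for receiver `0`, and sets
  -- obtained from these by unions, intersections and extension. The `e`s bound entropies above by
  -- link sizes, the `s`s are submodularity, and the `l`s bound entropies below by message sizes.
  have e0 := ext ∅ {0, 3, 4, 6} [0, 3, 4, 6] (by decide)
  have e1 := ext ∅ {1, 3, 5, 6} [1, 3, 5, 6] (by decide)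
  have e2 := ext ∅ {2, 4, 5, 6} [2, 4, 5, 6] (by decide)
  have e01 := ext ∅ {0, 1, 3, 4, 5, 6} [0, 1, 3, 4, 5, 6] (by decide)
  have e02 := ext ∅ {0, 2, 3, 4, 5, 6} [0, 2, 3, 4, 5, 6] (by decide)
  have e12 := ext ∅ {1, 2, 3, 4, 5, 6} [1, 2, 3, 4, 5, 6] (by decide)
  have eu := ext ∅ Finset.univ [0, 1, 2, 3, 4, 5, 6] (by decide)
  have e01u := ext {0, 1, 3, 4, 5, 6} Finset.univ [2] (by decide)
  have e02u := ext {0, 2, 3, 4, 5, 6} Finset.univ [1] (by decide)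
  have e12u := ext {1, 2, 3, 4, 5, 6} Finset.univ [0] (by decide)
  have e3 := ext {3, 6} {2, 3, 4, 5, 6} [2, 4, 5] (by decide)
  have e0u := ext {0, 3, 4, 5, 6} Finset.univ [1, 2] (by decide)
  have e1u := ext {1, 3, 4, 5, 6} Finset.univ [0, 2] (by decide)
  have e2u := ext {2, 3, 4, 5, 6} Finset.univ [0, 1] (by decide)
  have s01 := sub {0, 3, 4, 6} {1, 3, 5, 6} {0, 1, 3, 4, 5, 6} {3, 6} (by decide)
  have s02 := sub {0, 3, 4, 6} {2, 4, 5, 6} {0, 2, 3, 4, 5, 6} {4, 6} (by decide)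
  have s12 := sub {1, 3, 5, 6} {2, 4, 5, 6} {1, 2, 3, 4, 5, 6} {5, 6} (by decide)
  have s2 := sub {3, 6} {2, 4, 5, 6} {2, 3, 4, 5, 6} {6} (by decide)
  have s1 := sub {4, 6} {1, 3, 5, 6} {1, 3, 4, 5, 6} {6} (by decide)
  have s0 := sub {5, 6} {0, 3, 4, 6} {0, 3, 4, 5, 6} {6} (by decide)
  have su := sub {0, 1, 3, 4, 5, 6} {2, 3, 4, 5, 6} Finset.univ {3, 4, 5, 6} (by decide)
  have l0 := low {0, 3, 4, 6} [0, 3, 4, 6] (by decide)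
  have l1 := low {1, 3, 5, 6} [1, 3, 5, 6] (by decide)
  have l2 := low {2, 4, 5, 6} [2, 4, 5, 6] (by decide)
  have l01 := low {0, 1, 3, 4, 5, 6} [0, 1, 3, 4, 5, 6] (by decide)
  have l02 := low {0, 2, 3, 4, 5, 6} [0, 2, 3, 4, 5, 6] (by decide)
  have l12 := low {1, 2, 3, 4, 5, 6} [1, 2, 3, 4, 5, 6] (by decide)
  have lu := low Finset.univ [0, 1, 2, 3, 4, 5, 6] (by decide)
  have l3 := low {3, 6} [3, 6] (by decide)
  have l4 := low {4, 6} [4, 6] (by decide)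
  have l5 := low {5, 6} [5, 6] (by decide)
  have l6 := low {6} [6] (by decide)
  have l345 := low {3, 4, 5, 6} [3, 4, 5, 6] (by decide)
  clear sub ext low hsub hext hlow
  simp only [List.map_cons, List.map_nil, List.sum_cons, List.sum_nil, h0] at *
  constructor
  · linarith only [e0, l0, hK]
  · linarith only [e1, l1, hK]
  · linarith only [e2, l2, hK]
  · linarith only [e12, l12, hK]
  · linarith only [e02, l02, hK]
  · linarith only [e01, l01, hK]
  · linarith only [eu, lu, hK]
  · linarith only [e0, e1, s01, e3, su, lu, l345, hK]
  · linarith only [e1, e2, s12, e12u, lu, l5, hK]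
  · linarith only [e0, e2, s02, e02u, lu, l4, hK]
  · linarith only [e0, e1, s01, e01u, lu, l3, hK]
  · linarith only [e0, e1, e2, s12, s0, e0u, l12, lu, l6, hK]
  · linarith only [e0, e1, e2, s02, s1, e1u, l02, lu, l6, hK]
  · linarith only [e0, e1, e2, s01, s2, e2u, l01, lu, l6, hK]
  · linarith only [e0, e1, e2, s01, s2, e2u, e01u, lu, l6, hK]

/-- Messages whose weights lie in `H*₃`, which each receiver can recover from the links that it
sees. -/
theorem sum_mul_log_card_le {Ω : Type} [Fintype Ω] [Nonempty Ω] {S T : Fin 7 → Type}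
    [∀ I, Fintype (S I)] [∀ I, Fintype (T I)] (P : ∀ I, Ω → S I) (W : ∀ I, Ω → T I)
    (hdec : ∀ (i : Fin 3) (ω ω' : Ω), (∀ J, i ∈ recipients J → P J ω = P J ω') →
      ∀ I, i ∈ recipients I → W I ω = W I ω')
    (hinj : ∀ ω ω', (∀ I, W I ω = W I ω') → ω = ω') {K : ℝ} (hK : 0 ≤ K)
    (hcard : ∑ I, Real.log (Fintype.card (T I)) - K ≤ Real.log (Fintype.card Ω))
    {α : Fin 7 → ℝ} (hα : α ∈ Hstar3) :
    ∑ I, α I * Real.log (Fintype.card (T I)) ≤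
      ∑ I, α I * (Real.log (Fintype.card (S I)) + K) := by
  classical
  set g : Finset (Fin 7) → ℝ := fun F => unifEntropy (linkData P W F) with hg
  have hsub : ∀ F G : Finset (Fin 7), g (F ∪ G) + g (F ∩ G) ≤ g F + g G := by
    intro F G
    refine unifEntropy_submodular _ _ _ _ ?_ ?_ ?_ <;>
      simp only [linkData_eq_iff, Finset.mem_union, Finset.mem_inter]
    · exact fun ω ω' h I hI => h I hI.1
    · exact fun ω ω' h I hI => h I hI.2
    · rintro ω ω' h h' I (hI | hI)
      · exact h I hI
      · exact h' I hI
  have hlogsum : ∀ (X : Fin 7 → Type) [∀ I, Fintype (X I)] (_ : ∀ I, Nonempty (X I))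
      (E : Finset (Fin 7)),
      Real.log (Fintype.card (∀ I : E, X I)) = ∑ I ∈ E, Real.log (Fintype.card (X I)) := by
    intro X _ hX E
    rw [Fintype.card_pi, Nat.cast_prod, Real.log_prod fun I _ => Nat.cast_ne_zero.2
      Fintype.card_ne_zero]
    exact Finset.sum_coe_sort E fun I => Real.log (Fintype.card (X I))
  have hS : ∀ I, Nonempty (S I) := fun I => ‹Nonempty Ω›.map (P I)
  have hT : ∀ I, Nonempty (T I) := fun I => ‹Nonempty Ω›.map (W I)
  have hext : ∀ F E : Finset (Fin 7), (∀ I ∈ E, ∃ i ∈ recipients I, ∀ J, i ∈ recipients J →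
      J ∈ F ∪ E) → g (F ∪ E) ≤ g F + ∑ I ∈ E, Real.log (Fintype.card (S I)) := by
    intro F E hE
    rw [← hlogsum S hS]
    refine (unifEntropy_le_add (linkData P W F) (fun ω (I : E) => P I ω) _
      fun ω ω' h h' => ?_).trans (by gcongr; exact unifEntropy_le_log_card _)
    rw [linkData_eq_iff] at h ⊢
    rw [funext_iff] at h'
    have hP : ∀ J ∈ F ∪ E, P J ω = P J ω' := by
      intro J hJ
      rcases Finset.mem_union.1 hJ with hJ | hJ
      · exact (h J hJ).1
      · exact h' ⟨J, hJ⟩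
    intro I hI
    rcases Finset.mem_union.1 hI with hI | hI
    · exact h I hI
    · obtain ⟨i, hi, hiJ⟩ := hE I hI
      exact ⟨h' ⟨I, hI⟩, hdec i ω ω' (fun J hJ => hP J (hiJ J hJ)) I hi⟩
  have hlow : ∀ F : Finset (Fin 7), ∑ I ∈ F, Real.log (Fintype.card (T I)) - K ≤ g F := by
    intro F
    -- The messages outside `F` complete the data of `F` to the whole of `ω`, whose entropy falls
    -- short of the total message size by at most `K`.
    have h1 := unifEntropy_le_add (linkData P W F) (fun ω (I : (Fᶜ : Finset (Fin 7))) => W I ω)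
      (id : Ω → Ω) (fun ω ω' h h' => by
        rw [linkData_eq_iff] at h
        rw [funext_iff] at h'
        refine hinj ω ω' fun I => ?_
        by_cases hI : I ∈ F
        · exact (h I hI).2
        · exact h' ⟨I, Finset.mem_compl.2 hI⟩)
    have h2 := unifEntropy_le_log_card fun ω (I : (Fᶜ : Finset (Fin 7))) => W I ω
    rw [hlogsum T hT] at h2
    rw [unifEntropy_id] at h1
    have h3 := Finset.sum_add_sum_compl F fun I => Real.log (Fintype.card (T I))
    linarith
  have h0 : g ∅ = 0 := by
    have h1 := hext ∅ ∅ (by simp)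
    have h2 := unifEntropy_submodular (fun _ : Ω => ()) (fun _ : Ω => ()) (linkData P W ∅)
      (linkData P W ∅) (by simp [linkData_eq_iff]) (by simp [linkData_eq_iff])
      (by simp [linkData_eq_iff])
    have h3 := unifEntropy_submodular (linkData P W ∅) (linkData P W ∅) (fun _ : Ω => ())
      (fun _ : Ω => ()) (fun _ _ _ => rfl) (fun _ _ _ => rfl) (fun _ _ _ _ => rfl)
    rw [unifEntropy_const] at h2 h3
    simp only [hg]
    linarith
  have hnn := (nonnegOnRays_of_submodular hK hsub hext hlow h0).nonneg
    (FractionallySubadditive.of_mem_Hstar3 hα)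
  simp only [Fin.sum_univ_seven]
  linarith

/-! ### The link channels and bounds on their capacity regions. -/

/-- What receiver `i` sees of the input `x` of a channel that sends, in each use, a block over one
of seven links: the number of the link, and the block if the link leads to receiver `i`. -/
def linkOutput (κ : Fin 7 → ℕ) (i : Fin 3) (x : Σ I : Fin 7, Fin (2 ^ κ I)) :
    Σ I : Fin 7, Fin (2 ^ κ I) :=
  if i ∈ recipients x.1 then x else ⟨x.1, ⟨0, by positivity⟩⟩

theorem linkOutput_congr {κ : Fin 7 → ℕ} {i : Fin 3} {x x' : Σ I : Fin 7, Fin (2 ^ κ I)}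
    (h : x.1 = x'.1) (h' : i ∈ recipients x.1 → x = x') :
    linkOutput κ i x = linkOutput κ i x' := by
  by_cases hi : i ∈ recipients x.1
  · rw [h' hi]
  · obtain ⟨I, v⟩ := x
    obtain ⟨I', v'⟩ := x'
    obtain rfl : I = I' := h
    simp only [linkOutput, if_neg hi]

/-- The deterministic channel that sends, in each use, a block over one of seven links; the link `I`
leads to the recipients of the message `I`, and its blocks have `κ I` bits. -/
noncomputable abbrev linkChannel (κ : Fin 7 → ℕ) : BroadcastChannel where
  X := Σ I : Fin 7, Fin (2 ^ κ I)
  Y := fun _ => Σ I : Fin 7, Fin (2 ^ κ I)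
  fintypeX := inferInstance
  nonemptyX := ⟨⟨0, ⟨0, by positivity⟩⟩⟩
  fintypeY := fun _ => inferInstance
  p := fun x y => if y = fun i => linkOutput κ i x then 1 else 0
  p_nonneg := fun x y => by positivity
  p_sum := fun x => by simp

namespace BroadcastChannel

variable {κ : Fin 7 → ℕ}

theorem linkChannel_prod_p {ι : Type} [Fintype ι] (x : ι → (linkChannel κ).X)
    (y : ι → ∀ i, (linkChannel κ).Y i) [Decidable (y = fun t i => linkOutput κ i (x t))] :
    ∏ t, (linkChannel κ).p (x t) (y t) = if y = fun t i => linkOutput κ i (x t) then 1 else 0 := by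
  by_cases h : y = fun t i => linkOutput κ i (x t)
  · rw [if_pos h, h]
    exact Finset.prod_eq_one fun t _ => if_pos rfl
  · rw [if_neg h]
    obtain ⟨t, ht⟩ := Function.ne_iff.1 h
    exact Finset.prod_eq_zero (Finset.mem_univ t) (if_neg ht)

open Classical in
theorem linkChannel_errAt {ι : Type} [Fintype ι] {M : Fin 7 → Type}
    (enc : (∀ I, M I) → ι → (linkChannel κ).X)
    (dec : ∀ (i : Fin 3) (I : Fin 7), i ∈ recipients I → (ι → (linkChannel κ).Y i) → M I)
    (w : ∀ I, M I) :
    (linkChannel κ).errAt enc dec w =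
      if Misdecodes dec w (fun t i => linkOutput κ i (enc w t)) then 1 else 0 := by
  refine (Finset.sum_eq_single (fun t i => linkOutput κ i (enc w t)) (fun y _ hy => ?_)
    fun h => absurd (Finset.mem_univ _) h).trans ?_
  · rw [linkChannel_prod_p, if_neg hy, ite_self]
  · rw [linkChannel_prod_p, if_pos rfl]

/-- A code without errors. -/
theorem linkChannel_feasible {ι : Type} [Fintype ι] {M : Fin 7 → Type} [∀ I, Fintype (M I)]
    [∀ I, Nonempty (M I)] (enc : (∀ I, M I) → ι → (linkChannel κ).X)
    (hdec : ∀ i w w', (∀ t, linkOutput κ i (enc w t) = linkOutput κ i (enc w' t)) →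
      ∀ I, i ∈ recipients I → w I = w' I) : (linkChannel κ).Feasible ι M 0 := by
  classical
  let dec : ∀ (i : Fin 3) (I : Fin 7), i ∈ recipients I → (ι → (linkChannel κ).Y i) → M I :=
    fun i I _ y => if h : ∃ w, ∀ t, linkOutput κ i (enc w t) = y t then h.choose I
      else Classical.arbitrary _
  refine ⟨enc, dec, ?_⟩
  rw [zero_mul]
  refine (Finset.sum_eq_zero fun w _ => ?_).le
  rw [linkChannel_errAt, if_neg]
  rintro ⟨i, I, hI, hne⟩
  apply hne
  have h : ∃ w', ∀ t, linkOutput κ i (enc w' t) = linkOutput κ i (enc w t) := ⟨w, fun _ => rfl⟩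
  exact (dif_pos h).trans (hdec i _ _ h.choose_spec I hI)

/-- Use link `I` all the time; no errors occur. -/
theorem linkChannel_single_mem (κ : Fin 7 → ℕ) (I : Fin 7) :
    Pi.single I (κ I : ℝ) ∈ (linkChannel κ).capacityRegion := by
  classical
  refine subset_closure (achievable_iff.2 ⟨fun J => ?_, fun ε hε => Eventually.of_forall fun n => ?_⟩)
  · by_cases hJ : J = I
    · subst hJ; simp
    · simp [hJ]
  have hcard : Fintype.card (Fin (bitCount (n * (Pi.single I (κ I : ℝ) : Fin 7 → ℝ) I))) ≤
      Fintype.card (Fin n → Fin (2 ^ κ I)) := by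
    have h1 := bitCount_le (n * (κ I : ℝ))
    rw [← Nat.cast_mul, Real.rpow_natCast, mul_comm n, pow_mul] at h1
    simp only [Pi.single_eq_same, Fintype.card_fin, Fintype.card_pi, Finset.prod_const,
      Finset.card_univ]
    rw [← Nat.cast_mul, mul_comm n]
    exact_mod_cast h1
  obtain ⟨e⟩ := Function.Embedding.nonempty_of_card_le hcard
  have hne := nonempty_fin_bitCount (R := Pi.single I (κ I : ℝ)) (fun J => by
    by_cases hJ : J = I
    · subst hJ; simp
    · simp [hJ]) n
  refine (linkChannel_feasible (fun w t => ⟨I, e (w I) t⟩) fun i w w' h J hJ => ?_).mono hε.le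
  by_cases hJI : J = I
  · subst hJI
    refine e.injective (funext fun t => ?_)
    have := h t
    simp only [linkOutput, if_pos hJ] at this
    exact eq_of_heq (Sigma.mk.inj_iff.1 this).2
  · have : Subsingleton (Fin (bitCount (n * (Pi.single I (κ I : ℝ) : Fin 7 → ℝ) J))) := by
      have h1 : bitCount (n * (Pi.single I (κ I : ℝ) : Fin 7 → ℝ) J) = 1 := by
        simp [hJI, bitCount]
      rw [h1]
      infer_instance
    exact Subsingleton.elim _ _

/-- Fix the most frequent sequence of link numbers among the correctly decoded message vectors. This
costs a factor at most `2 * 7 ^ n` in their number and leaves seven noiseless links, to which the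
entropy bound applies. -/
theorem linkChannel_card_le {n : ℕ} {M : Fin 7 → Type} [∀ I, Fintype (M I)]
    [∀ I, Nonempty (M I)] (h : (linkChannel κ).Feasible (Fin n) M (1 / 2)) {α : Fin 7 → ℝ}
    (hα : α ∈ Hstar3) {L : ℝ} (hL : ∀ I, α I * κ I ≤ L) :
    ∑ I, α I * Real.log (Fintype.card (M I)) ≤
      n * L * Real.log 2 + (∑ I, α I) * Real.log (2 * 7 ^ n) := by
  classical
  obtain ⟨enc, dec, he⟩ := h
  let mode : (∀ I, M I) → Fin n → Fin 7 := fun w t => (enc w t).1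
  let good : Finset (∀ I, M I) :=
    Finset.univ.filter fun w => ¬ Misdecodes dec w (fun t i => linkOutput κ i (enc w t))
  have hpos : (0 : ℝ) < Fintype.card (∀ I, M I) := Nat.cast_pos.2 Fintype.card_pos
  have hgood : (Fintype.card (∀ I, M I) : ℝ) / 2 ≤ good.card := by
    simp only [linkChannel_errAt, Finset.sum_boole] at he
    have h1 := Finset.card_filter_add_card_filter_not (s := (Finset.univ : Finset (∀ I, M I)))
      (fun w => Misdecodes dec w (fun t i => linkOutput κ i (enc w t)))
    have h2 : ((Finset.univ.filter fun w =>
      Misdecodes dec w (fun t i => linkOutput κ i (enc w t))).card : ℝ) + good.card =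
        Fintype.card (∀ I, M I) := by exact_mod_cast h1
    linarith
  obtain ⟨q, -, hq⟩ := Finset.exists_le_card_fiber_of_nsmul_le_card_of_maps_to (s := good)
    (t := (Finset.univ : Finset (Fin n → Fin 7))) (f := mode)
    (b := (Fintype.card (∀ I, M I) : ℝ) / (2 * 7 ^ n)) (fun _ _ => Finset.mem_univ _)
    Finset.univ_nonempty (by
      refine le_trans (le_of_eq ?_) hgood
      simp
      field_simp)
  set s := good.filter fun w => mode w = q with hs
  have hspos : (0 : ℝ) < s.card := lt_of_lt_of_le (by positivity) hq
  have hsne : s.Nonempty := Finset.card_pos.1 (by exact_mod_cast hspos)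
  have : Nonempty s := hsne.to_subtype
  have hmode : ∀ (w : s) t, (enc w t).1 = q t := fun w t =>
    congrFun (Finset.mem_filter.1 w.2).2 t
  have hok : ∀ (w : s) i I (hI : i ∈ recipients I),
      dec i I hI (fun t => linkOutput κ i (enc w t)) = w.1 I := by
    intro w i I hI
    have h1 := (Finset.mem_filter.1 (Finset.mem_filter.1 w.2).1).2
    by_contra hne
    exact h1 ⟨i, I, hI, hne⟩
  have key := sum_mul_log_card_le (Ω := s)
    (S := fun I => {t // q t = I} → {x : Σ I : Fin 7, Fin (2 ^ κ I) // x.1 = I}) (T := M)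
    (fun I w t => ⟨enc w t.1, (hmode w t.1).trans t.2⟩) (fun I w => w.1 I) (fun i w w' hP I hI => ?_)
    (fun w w' hw => Subtype.ext (funext hw)) (K := Real.log (2 * 7 ^ n))
    (Real.log_nonneg (by
      have := one_le_pow₀ (show (1 : ℝ) ≤ 7 by norm_num) (n := n)
      linarith)) ?_ hα
  · refine key.trans ?_
    simp only [mul_add, Finset.sum_add_distrib, ← Finset.sum_mul]
    gcongr
    have hc : ∀ I, Real.log (Fintype.card
        ({t // q t = I} → {x : Σ I : Fin 7, Fin (2 ^ κ I) // x.1 = I})) =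
        Fintype.card {t // q t = I} * (κ I * Real.log 2) := by
      intro I
      rw [Fintype.card_fun, Fintype.card_congr (Equiv.sigmaSubtype I), Fintype.card_fin]
      push_cast
      rw [Real.log_pow, Real.log_pow]
    have hn : ∑ I, (Fintype.card {t // q t = I} : ℝ) = n := by
      have := Fintype.card_congr (Equiv.sigmaFiberEquiv q)
      rw [Fintype.card_sigma, Fintype.card_fin] at this
      exact_mod_cast this
    simp only [hc]
    rw [← hn, Finset.sum_mul, Finset.sum_mul]
    refine Finset.sum_le_sum fun I _ => ?_
    have h1 := mul_le_mul_of_nonneg_left (hL I) (Nat.cast_nonneg (α := ℝ)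
      (Fintype.card {t // q t = I}))
    have h2 := mul_le_mul_of_nonneg_right h1 (Real.log_nonneg (show (1 : ℝ) ≤ 2 by norm_num))
    linarith
  · rw [← hok w i I hI, ← hok w' i I hI]
    congr 1
    funext t
    refine linkOutput_congr ((hmode w t).trans (hmode w' t).symm) fun hi => ?_
    exact congrArg Subtype.val (congrFun (hP (q t) (hmode w t ▸ hi)) ⟨t, rfl⟩)
  · have h1 : ∑ I, Real.log (Fintype.card (M I)) = Real.log (Fintype.card (∀ I, M I)) := by
      rw [Fintype.card_pi, Nat.cast_prod, Real.log_prod fun I _ => Nat.cast_ne_zero.2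
        Fintype.card_ne_zero]
    rw [h1, Fintype.card_coe, ← Real.log_div hpos.ne' (by positivity)]
    exact Real.log_le_log (by positivity) hq

/-- The `5` is `3 + 1 + 1` bits per use: `7 ≤ 2 ^ 3` link numbers, the factor `2` for decoding
errors, and rounding of message counts. The last two occur once per block, and `n ≥ 1`. -/
theorem linkChannel_dotProduct_le {α : Fin 7 → ℝ} (hα : α ∈ Hstar3) {L : ℝ}
    (hL : ∀ I, α I * κ I ≤ L) {R : Fin 7 → ℝ} (hR : R ∈ (linkChannel κ).capacityRegion) :
    α ⬝ᵥ R ≤ L + 5 * ∑ I, α I := by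
  have hα0 := (mem_Hstar3_iff.1 hα).1
  have hA : 0 ≤ ∑ I, α I := Finset.sum_nonneg fun I _ => hα0 I
  have hcl : IsClosed {R : Fin 7 → ℝ | α ⬝ᵥ R ≤ L + 5 * ∑ I, α I} := by
    refine isClosed_le ?_ continuous_const
    unfold dotProduct
    fun_prop
  refine closure_minimal (fun r hr => ?_) hcl hR
  have hr' := achievable_iff.1 hr
  obtain ⟨n, hn, hn1⟩ := ((hr'.2 (1 / 2) (by norm_num)).and (eventually_ge_atTop 1)).exists
  have := nonempty_fin_bitCount hr'.1 n
  have key := linkChannel_card_le hn hα hL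
  have hn1' : (1 : ℝ) ≤ n := by exact_mod_cast hn1
  have hl2 : 0 < Real.log 2 := Real.log_pos (by norm_num)
  have h7 : Real.log (2 * 7 ^ n) ≤ Real.log 2 + n * (3 * Real.log 2) := by
    rw [Real.log_mul (by norm_num) (by positivity), Real.log_pow]
    gcongr
    have : (3 : ℝ) * Real.log 2 = Real.log (2 ^ 3) := by rw [Real.log_pow]; norm_num
    rw [this]
    exact Real.log_le_log (by norm_num) (by norm_num)
  have hlow : ∑ I, α I * ((n * r I - 1) * Real.log 2) ≤
      ∑ I, α I * Real.log (Fintype.card (Fin (bitCount (n * r I)))) := by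
    refine Finset.sum_le_sum fun I _ => mul_le_mul_of_nonneg_left ?_ (hα0 I)
    rw [Fintype.card_fin, ← Real.log_rpow (by norm_num)]
    exact Real.log_le_log (by positivity) (le_bitCount (mul_nonneg n.cast_nonneg (hr'.1 I)))
  have hsum : ∑ I, α I * ((n * r I - 1) * Real.log 2) =
      (n * (α ⬝ᵥ r) - ∑ I, α I) * Real.log 2 := by
    simp only [dotProduct, Finset.mul_sum, ← Finset.sum_sub_distrib, Finset.sum_mul]
    exact Finset.sum_congr rfl fun I _ => by ring
  rw [hsum] at hlow
  have h8 := mul_le_mul_of_nonneg_left h7 hA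
  have h9 : (n * (α ⬝ᵥ r) - ∑ I, α I) * Real.log 2 ≤
      (n * L + (∑ I, α I) * (1 + 3 * n)) * Real.log 2 := by linarith
  have h10 := le_of_mul_le_mul_right h9 hl2
  show α ⬝ᵥ r ≤ L + 5 * ∑ I, α I
  by_contra! hcon
  nlinarith [mul_le_mul_of_nonneg_left hn1' hA]

end BroadcastChannel

/-! ### Necessity of the weights in `Hstar3`. -/

namespace BroadcastChannel

theorem exists_pos_mem_Hstar3 {U : Set (Fin 7 → ℝ)} (hU : IsOpen U) {α : Fin 7 → ℝ}
    (hα : α ∈ Hstar3) (hαU : α ∈ U) : ∃ β ∈ Hstar3, β ∈ U ∧ ∀ I, 0 < β I := by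
  -- The number of recipients: a positive element of `Hstar3`.
  let v : Fin 7 → ℝ := ![1, 1, 1, 2, 2, 2, 3]
  have hc : Continuous fun s : ℝ => α + s • v := by fun_prop
  have hev : ∀ᶠ s : ℝ in 𝓝[>] 0, α + s • v ∈ U :=
    nhdsWithin_le_nhds (hc.continuousAt.preimage_mem_nhds (hU.mem_nhds (by simpa using hαU)))
  obtain ⟨s, hs, hs0 : 0 < s⟩ := (hev.and self_mem_nhdsWithin).exists
  obtain ⟨h0, ⟨h1, h2, h3⟩, ⟨h4, h5, h6, h7, h8, h9⟩, ⟨h10, h11, h12⟩, ⟨h13, h14, h15⟩, h16⟩ :=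
    mem_Hstar3_iff.1 hα
  have hpos : ∀ I, 0 < (α + s • v) I := by
    intro I
    have : 0 < v I := by fin_cases I <;> simp [v]
    have := h0 I
    simp only [Pi.add_apply, Pi.smul_apply, smul_eq_mul]
    positivity
  refine ⟨α + s • v, mem_Hstar3_iff.2 ⟨fun I => (hpos I).le, ?_⟩, hs, hpos⟩
  have v3 : v 3 = 2 := rfl
  have v4 : v 4 = 2 := rfl
  have v5 : v 5 = 2 := rfl
  have v6 : v 6 = 3 := rfl
  have v0 : v 0 = 1 := rfl
  have v1 : v 1 = 1 := rfl
  have v2 : v 2 = 1 := rfl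
  simp only [Pi.add_apply, Pi.smul_apply, smul_eq_mul, v0, v1, v2, v3, v4, v5, v6]
  and_intros <;> linarith

/-- Weights that determine the capacity region of every channel are dense in `H*₃` up to scaling. -/
theorem Hstar3_subset_closure_raysThrough {A : Set (Fin 7 → ℝ)} (hA : ∀ α ∈ A, ∀ I, 0 ≤ α I)
    (h : ∀ ch : BroadcastChannel, ch.capacityRegion = ⋂ α ∈ A, ch.supportingHalfspace α) :
    Hstar3 ⊆ closure (raysThrough A) := by
  intro α₀ hα₀
  by_contra hnot
  obtain ⟨α, hα, hαU, hpos⟩ := exists_pos_mem_Hstar3 isClosed_closure.isOpen_compl hα₀ hnot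
  obtain ⟨δ, hδ, hball⟩ := Metric.isOpen_iff.1 isClosed_closure.isOpen_compl α hαU
  set s := ∑ I, α I with hs
  have hle : ∀ I, α I ≤ s := fun I =>
    Finset.single_le_sum (f := α) (fun J _ => (hpos J).le) (Finset.mem_univ I)
  have hs0 : 0 < s := (hpos 0).trans_le (hle 0)
  obtain ⟨η, hη0, hη1, hηδ⟩ : ∃ η : ℝ, 0 < η ∧ η ≤ 1 ∧ 12 * η * s < δ := by
    refine ⟨min 1 (δ / (24 * s)), by positivity, min_le_left _ _, ?_⟩
    have h1 : min 1 (δ / (24 * s)) ≤ δ / (24 * s) := min_le_right _ _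
    rw [le_div_iff₀ (by positivity)] at h1
    linarith
  -- So `η * L = 6 * s` exceeds the error term `5 * s` in the upper bound for the region.
  set L := 6 * s / η with hL
  have hηL : η * L = 6 * s := by rw [hL]; field_simp
  have hL0 : 0 < L := by positivity
  let κ : Fin 7 → ℕ := fun I => ⌊L / α I⌋₊
  have hκ1 : ∀ I, α I * κ I ≤ L := fun I => by
    have := Nat.floor_le (show 0 ≤ L / α I from (div_pos hL0 (hpos I)).le)
    rw [le_div_iff₀ (hpos I)] at this
    rw [mul_comm]
    exact this
  have hκ2 : ∀ I, L - α I ≤ α I * κ I := fun I => by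
    have := (Nat.lt_floor_add_one (L / α I)).le
    rw [div_le_iff₀ (hpos I)] at this
    have e : ((κ I : ℝ) + 1) * α I = α I * κ I + α I := by ring
    have : L ≤ ((κ I : ℝ) + 1) * α I := this
    linarith
  -- The centre of the simplex with corners `L / α I`, pushed out by the factor `1 + η`, which is
  -- just enough to leave the region.
  let R : Fin 7 → ℝ := fun I => (1 + η) * L / 7 / α I
  have hR0 : ∀ I, 0 ≤ R I := fun I => by
    have := hpos I
    positivity
  have hRC : R ∉ (linkChannel κ).capacityRegion := by
    intro hR
    have h1 := linkChannel_dotProduct_le hα hκ1 hR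
    have h2 : α ⬝ᵥ R = (1 + η) * L := by
      have : ∀ I, α I * R I = (1 + η) * L / 7 := fun I => by
        have := (hpos I).ne'
        simp only [R]
        field_simp
      simp only [dotProduct, this]
      simp
      ring
    rw [h2] at h1
    linarith
  rw [h, Set.mem_iInter₂] at hRC
  push Not at hRC
  obtain ⟨a, ha, haR⟩ := hRC
  rw [mem_supportingHalfspace_iff] at haR
  push Not at haR
  have haR' := fun I => haR hR0 _ (linkChannel_single_mem κ I)
  -- The corners, which lie in the region, have smaller `a`-weight than `R`. Hence no ratio `x I`
  -- much exceeds the mean `m`, and `a` is nearly `m • α`.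
  set x : Fin 7 → ℝ := fun I => a I / α I with hx
  have hx0 : ∀ I, 0 ≤ x I := fun I => div_nonneg (hA a ha I) (hpos I).le
  have hax : ∀ I, a I = x I * α I := fun I => (div_mul_cancel₀ _ (hpos I).ne').symm
  set m := (∑ I, x I) / 7 with hm
  have haRm : a ⬝ᵥ R = (1 + η) * L * m := by
    have : ∀ I, a I * R I = x I * ((1 + η) * L / 7) := fun I => by
      have := (hpos I).ne'
      simp only [R, hax I]
      field_simp
    simp only [dotProduct, this, ← Finset.sum_mul, hm]
    ring
  have hlt : ∀ I, x I * (L - α I) < (1 + η) * L * m := fun I => by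
    have h1 := haR' I
    rw [haRm, dotProduct_single, hax, mul_assoc] at h1
    exact (mul_le_mul_of_nonneg_left (hκ2 I) (hx0 I)).trans_lt h1
  have hLα : ∀ I, 0 < L - α I := fun I => by
    have := hle I
    nlinarith
  have hm0 : 0 < m := by
    have h1 := (mul_nonneg (hx0 0) (hLα 0).le).trans_lt (hlt 0)
    exact pos_of_mul_pos_right h1 (by positivity)
  have hup : ∀ I, x I ≤ (1 + 2 * η) * m := fun I => by
    refine le_of_mul_le_mul_right (a := L - α I) ?_ (hLα I)
    refine (hlt I).le.trans ?_
    have h1 : (1 + η) * L ≤ (1 + 2 * η) * (L - α I) := by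
      nlinarith [hle I, hpos I]
    calc (1 + η) * L * m ≤ (1 + 2 * η) * (L - α I) * m := mul_le_mul_of_nonneg_right h1 hm0.le
      _ = _ := by ring
  -- The seven ratios sum to `7 * m` and six of them are at most `(1 + 2 * η) * m` each.
  have hlow : ∀ I, (1 - 12 * η) * m ≤ x I := fun I => by
    have h1 : ∑ J, x J = 7 * m := by rw [hm]; ring
    have h2 := Finset.add_sum_erase Finset.univ x (Finset.mem_univ I)
    have h3 : ∑ J ∈ Finset.univ.erase I, x J ≤ ∑ _J ∈ Finset.univ.erase I, (1 + 2 * η) * m :=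
      Finset.sum_le_sum fun J _ => hup J
    rw [Finset.sum_const, Finset.card_erase_of_mem (Finset.mem_univ I)] at h3
    simp at h3
    linarith
  refine hball (Metric.mem_ball.2 ((dist_pi_lt_iff hδ).2 fun I => ?_))
    (subset_closure ⟨m⁻¹, (inv_pos.2 hm0).le, a, ha, rfl⟩)
  rw [Real.dist_eq, Pi.smul_apply, smul_eq_mul, hax I]
  have h1 : m⁻¹ * (x I * α I) - α I = (x I / m - 1) * α I := by
    field_simp
  have h2 : |x I / m - 1| ≤ 12 * η := by
    rw [abs_le]
    constructor
    · have := (le_div_iff₀ hm0).2 (hlow I)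
      linarith
    · have := (div_le_iff₀ hm0).2 (hup I)
      linarith
  rw [h1, abs_mul, abs_of_pos (hpos I)]
  calc |x I / m - 1| * α I ≤ 12 * η * s :=
        mul_le_mul h2 (hle I) (hpos I).le (by positivity)
    _ < δ := hηδ

end BroadcastChannel

theorem mainTheorem3 :
    -- the capacity region is cut out by the halfspaces with weights in `H*₃`
    (∀ ch : BroadcastChannel,
      ch.capacityRegion = ⋂ α ∈ Hstar3, ch.supportingHalfspace α) ∧
    -- which sets of weights suffice for all channels, up to scaling and limits of weights
    (∀ A : Set (Fin 7 → ℝ), (∀ α ∈ A, ∀ I, 0 ≤ α I) →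
      ((∀ ch : BroadcastChannel, ch.capacityRegion = ⋂ α ∈ A, ch.supportingHalfspace α) ↔
        Hstar3 ⊆ closure (raysThrough A))) ∧
    -- in particular, which closed cones of weights suffice for all channels
    (∀ A : Set (Fin 7 → ℝ), (∀ α ∈ A, ∀ I, 0 ≤ α I) → IsClosed A →
      (∀ α ∈ A, ∀ t : ℝ, 0 < t → t • α ∈ A) →
      ((∀ ch : BroadcastChannel, ch.capacityRegion = ⋂ α ∈ A, ch.supportingHalfspace α) ↔
        Hstar3 ⊆ A)) ∧
    -- every normal vector at a point of the region with positive rates lies in `H*₃`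
    (∀ (ch : BroadcastChannel) (R α : Fin 7 → ℝ), (∀ I, 0 < R I) →
      R ∈ ch.sumRateMaximizers α → α ∈ Hstar3) ∧
    -- every point of the boundary relative to the orthant has a nonzero normal vector in `H*₃`
    (∀ (ch : BroadcastChannel) (R : Fin 7 → ℝ), R ∈ ch.capacityRegion →
      R ∈ closure ({R' | ∀ I, 0 ≤ R' I} \ ch.capacityRegion) →
      ∃ α ∈ Hstar3, α ≠ 0 ∧ R ∈ ch.sumRateMaximizers α) := by
  refine ⟨fun ch => BroadcastChannel.capacityRegion_eq_iInter
      ((BroadcastChannel.subset_raysThrough _).trans subset_closure),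
    fun A hA => ⟨BroadcastChannel.Hstar3_subset_closure_raysThrough hA,
      fun h ch => BroadcastChannel.capacityRegion_eq_iInter h⟩,
    fun A hA hcl hcone => ?_,
    fun ch R α hR h => BroadcastChannel.mem_Hstar3_of_mem_sumRateMaximizers hR h,
    fun ch R hR hb => BroadcastChannel.exists_normal_mem_Hstar3 hR hb⟩
  have hc := BroadcastChannel.closure_raysThrough hcl hcone
  exact ⟨fun h => (BroadcastChannel.Hstar3_subset_closure_raysThrough hA h).trans hc.subset,
    fun h ch => BroadcastChannel.capacityRegion_eq_iInter (h.trans hc.symm.subset)⟩
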